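/- \textbf{Setting.} All Hilbert spaces are complex. A \emph{system node} $\Sigma=(A,B,C,\mathbf G)$ on $(U,X,Y)$ (Hilbert spaces) consists of the generator $A$ of a strongly continuous semigroup on $X$, operators $B\in\mathcal L(U,X_{-1})$ and $C\in\mathcal L(X_1,Y)$, and a function $\mathbf G:\rho(A)\to\mathcal L(U,Y)$ such that $\mathbf G(s)-\mathbf G(\beta)=C[(sI-A)^{-1}-(\beta I-A)^{-1}]B$ for all $s,\beta\in\rho(A)$. Here, for some fixed $\alpha\in\rho(A)$, $X_1$ is $\mathcal D(A)$ with the norm $\|(\alpha I-A)x\|$ and $X_{-1}$ is the completion of $X$ in the norm $\|(\alpha I-A)^{-1}x\|$; $A$ and $(sI-A)^{-1}$ also denote the continuous extensions $X\to X_{-1}$ and $X_{-1}\to X$. Let $V=\{(x,v)\in X\times U: Ax+Bv\in X\}$, and for $(x,v)\in V$ let $C\&D(x,v)=C[x-(\beta I-A)^{-1}Bv]+\mathbf G(\beta)v$, which does not depend on $\beta\in\rho(A)$. For a continuous function $u:[0,\infty)\to U$ and $z_0\in X$, we say that $z$ and $y$ are the state trajectory and the output function of $\Sigma$ for the initial state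 $z_0$ and the input function $u$ if $z\in C^1([0,\infty),X)$, $z(0)=z_0$ and $\dot z(t)=Az(t)+Bu(t)$, $y(t)=C\&D(z(t),u(t))$ for all $t\ge 0$. (They are unique if they exist. They exist if $(z_0,u)\in\mathcal D_0$, that is, if $u\in C^2([0,\infty),U)$ and $(z_0,u(0))\in V$.) The node $\Sigma$ is \emph{scattering passive} if for all $(z_0,u)\in\mathcal D_0$ and all $\tau>0$ $$\|z(\tau)\|^2-\|z_0\|^2\le\int_0^\tau\|u(t)\|^2\,dt-\int_0^\tau\|y(t)\|^2\,dt,$$ and, for $Y=U$, it is \emph{impedance passive} if for all $(z_0,u)\in\mathcal D_0$ and all $\tau>0$ $$\|z(\tau)\|^2-\|z_0\|^2\le 2\int_0^\tau\mathrm{Re}\,\langle u(t),y(t)\rangle\,dt.$$ $H^\infty$ denotes the space of bounded analytic $\mathcal L(U)$-valued functions on $\mathbb C_0=\{s\in\mathbb C:\mathrm{Re}\,s>0\}$. \textbf{Proposition.} Let $\Sigma^p$ be an impedance passive system node on $(U,X,U)$ with semigroup generator $A^p$ and transfer function $\mathbf G^p$, and let $k>0$. Then there is a unique scattering passive system node $\Sigma^s$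 on $(U,X,U)$ with the following property: whenever $(z_0,u^p)$ belongs to the set $\mathcal D_0$ of $\Sigma^p$ and $z,y^p$ are the corresponding state trajectory and output function of $\Sigma^p$, then for the same initial state $z_0$ and the (continuous) input function $$u^s=\sqrt{\tfrac k2}\Big(\frac{u^p}{k}+y^p\Big)$$ the state trajectory of $\Sigma^s$ is again $z$, and its output function is $$y^s=\sqrt{\tfrac k2}\Big(\frac{u^p}{k}-y^p\Big).$$ Moreover, $\mathbb C_0\subset\rho(A^p)$, the operator $I+k\mathbf G^p(s)$ has a bounded inverse for every $s\in\mathbb C_0$, and $(I+k\mathbf G^p)^{-1}\in H^\infty$. Let $A^s$ be the semigroup generator and $\mathbf G^s$ the transfer function of $\Sigma^s$. Then $\mathbb C_0\subset\rho(A^s)$, and for every $s\in\rho(A^p)\cap\rho(A^s)$ (in particular for every $s\in\mathbb C_0$) the operator $I+k\mathbf G^p(s)$ has a bounded inverse and $$\mathbf G^s(s)=(I-k\mathbf G^p(s))(I+k\mathbf G^p(s))^{-1}.$$ -/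

import Mathlib

open Set Filter Topology MeasureTheory

noncomputable section

namespace SysNode

section Resolvent

variable {X : Type*} [NormedAddCommGroup X] [InnerProductSpace ℂ X]

/-- `R` is the bounded inverse `(s I - A)⁻¹` of `s I - A : D(A) → X`. -/
def IsResolvent (A : X →ₗ.[ℂ] X) (s : ℂ) (R : X →L[ℂ] X) : Prop :=
  (∀ x : X, ∃ h : R x ∈ A.domain, s • R x - A ⟨R x, h⟩ = x) ∧
    ∀ x : A.domain, R (s • (x : X) - A x) = x

/-- The resolvent set `ρ(A)` of the (unbounded) operator `A`. -/
def rho (A : X →ₗ.[ℂ] X) : Set ℂ := {s | ∃ R : X →L[ℂ] X, IsResolvent A s R}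

/-- The resolvent operator `(s I - A)⁻¹` on `X`, for `s ∈ ρ(A)`. -/
def res (A : X →ₗ.[ℂ] X) (s : ℂ) : X →L[ℂ] X := Classical.epsilon (IsResolvent A s)

/-- A point `α` of `ρ(A)` (whenever `ρ(A)` is not empty, as for every semigroup generator). It is
used to norm the spaces `X₁` and `X₋₁`; another choice leads to equivalent norms. -/
def basePoint (A : X →ₗ.[ℂ] X) : ℂ := Classical.epsilon (fun α => α ∈ rho A)

theorem res_spec {A : X →ₗ.[ℂ] X} {s : ℂ} (hs : s ∈ rho A) : IsResolvent A s (res A s) :=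
  Classical.epsilon_spec hs

theorem basePoint_mem {A : X →ₗ.[ℂ] X} (h : (rho A).Nonempty) : basePoint A ∈ rho A :=
  Classical.epsilon_spec h

theorem res_mem {A : X →ₗ.[ℂ] X} {s : ℂ} (hs : s ∈ rho A) (x : X) : res A s x ∈ A.domain :=
  ((res_spec hs).1 x).1

/-- The resolvent identity. -/
theorem res_sub_res {A : X →ₗ.[ℂ] X} {s β : ℂ} (hs : s ∈ rho A) (hβ : β ∈ rho A) (x : X) :
    res A s x - res A β x = (β - s) • res A s (res A β x) := by
  obtain ⟨h, hx⟩ := (res_spec hβ).1 x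
  have h1 := (res_spec hs).2 ⟨res A β x, h⟩
  simp only at h1
  have h2 : s • res A β x - A ⟨res A β x, h⟩ = x - (β - s) • res A β x := by
    have hx' : x + A ⟨res A β x, h⟩ = β • res A β x := (sub_eq_iff_eq_add.1 hx).symm
    rw [sub_smul, ← hx']
    abel
  rw [h2, map_sub, map_smul] at h1
  rw [sub_eq_iff_eq_add, ← sub_eq_iff_eq_add']
  exact h1

end Resolvent

section Spaces

variable {X : Type*} [NormedAddCommGroup X] [InnerProductSpace ℂ X]

/-- The linear map `x ↦ (α I - A) x` on `D(A)`, with `α` the base point. -/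
def shift (A : X →ₗ.[ℂ] X) : A.domain →ₗ[ℂ] X := basePoint A • A.domain.subtype - A.toFun

/-- The space `X₁`: the domain `D(A)` with the norm `‖x‖₁ = ‖(α I - A) x‖`. -/
def XOne (A : X →ₗ.[ℂ] X) : Type _ := A.domain

instance (A : X →ₗ.[ℂ] X) : AddCommGroup (XOne A) := inferInstanceAs (AddCommGroup A.domain)
instance (A : X →ₗ.[ℂ] X) : Module ℂ (XOne A) := inferInstanceAs (Module ℂ A.domain)

/-- The linear map `x ↦ (α I - A) x` on `X₁`, which gives the norm of `X₁`. -/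
def XOne.shift (A : X →ₗ.[ℂ] X) : XOne A →ₗ[ℂ] X := SysNode.shift A

instance (A : X →ₗ.[ℂ] X) : SeminormedAddCommGroup (XOne A) :=
  SeminormedAddCommGroup.induced (XOne A) X (XOne.shift A)

instance (A : X →ₗ.[ℂ] X) : NormedSpace ℂ (XOne A) := NormedSpace.induced ℂ (XOne A) X (XOne.shift A)

/-- An element of `D(A)` as an element of `X₁`. -/
def XOne.mk (A : X →ₗ.[ℂ] X) (x : X) (h : x ∈ A.domain) : XOne A := (⟨x, h⟩ : A.domain)

theorem XOne.norm_mk (A : X →ₗ.[ℂ] X) (x : X) (h : x ∈ A.domain) :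
    ‖XOne.mk A x h‖ = ‖basePoint A • x - A ⟨x, h⟩‖ := rfl

/-- The space `X` with the norm `‖x‖₋₁ = ‖(α I - A)⁻¹ x‖`. -/
def XPre (_A : X →ₗ.[ℂ] X) : Type _ := X

instance (A : X →ₗ.[ℂ] X) : AddCommGroup (XPre A) := inferInstanceAs (AddCommGroup X)
instance (A : X →ₗ.[ℂ] X) : Module ℂ (XPre A) := inferInstanceAs (Module ℂ X)

/-- The linear map `x ↦ (α I - A)⁻¹ x`, which gives the norm of `XPre A`. -/
def XPre.res (A : X →ₗ.[ℂ] X) : XPre A →ₗ[ℂ] X := (SysNode.res A (basePoint A)).toLinearMap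

instance (A : X →ₗ.[ℂ] X) : SeminormedAddCommGroup (XPre A) :=
  SeminormedAddCommGroup.induced (XPre A) X (XPre.res A)

instance (A : X →ₗ.[ℂ] X) : NormedSpace ℂ (XPre A) := NormedSpace.induced ℂ (XPre A) X (XPre.res A)

/-- The space `X₋₁`: the completion of `X` with respect to `‖x‖₋₁ = ‖(α I - A)⁻¹ x‖`. -/
abbrev XNeg (A : X →ₗ.[ℂ] X) : Type _ := UniformSpace.Completion (XPre A)

/-- The identity map from `X` to `XPre A`. -/
def toXPre (A : X →ₗ.[ℂ] X) : X →ₗ[ℂ] XPre A := (LinearMap.id : X →ₗ[ℂ] X)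

/-- The embedding of `X` into `X₋₁`. -/
def emb (A : X →ₗ.[ℂ] X) : X →ₗ[ℂ] XNeg A :=
  (UniformSpace.Completion.toComplₗᵢ (𝕜 := ℂ) (E := XPre A)).toLinearMap ∘ₗ toXPre A

theorem norm_emb (A : X →ₗ.[ℂ] X) (x : X) : ‖emb A x‖ = ‖res A (basePoint A) x‖ :=
  UniformSpace.Completion.norm_coe (E := XPre A) x

theorem denseRange_emb (A : X →ₗ.[ℂ] X) : DenseRange (emb A) :=
  UniformSpace.Completion.denseRange_coe (α := XPre A)

/-- The extension of `A` to an operator in `𝓛(X, X₋₁)` (by continuity, from `D(A)`). -/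
def AExt (A : X →ₗ.[ℂ] X) : X →L[ℂ] XNeg A :=
  (emb A ∘ₗ A.toFun).extendOfNorm A.domain.subtype

theorem AExt_apply {A : X →ₗ.[ℂ] X} (hA : Dense (A.domain : Set X)) (hρ : (rho A).Nonempty)
    (x : A.domain) : AExt A x = emb A (A x) := by
  refine LinearMap.extendOfNorm_eq (f := emb A ∘ₗ A.toFun) (e := A.domain.subtype)
    (by simpa [DenseRange] using hA)
    ⟨‖basePoint A • res A (basePoint A) - ContinuousLinearMap.id ℂ X‖, fun y => ?_⟩ x
  have h := (res_spec (basePoint_mem hρ)).2 y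
  have h2 : res A (basePoint A) (A y) =
      (basePoint A • res A (basePoint A) - ContinuousLinearMap.id ℂ X) (y : X) := by
    rw [map_sub, map_smul, sub_eq_iff_eq_add] at h
    simp [h]
  calc ‖emb A (A y)‖ = ‖res A (basePoint A) (A y)‖ := norm_emb A _
    _ ≤ _ := by rw [h2]; exact ContinuousLinearMap.le_opNorm _ _

variable [CompleteSpace X]

/-- The extension of `(s I - A)⁻¹` to an operator in `𝓛(X₋₁, X)` (by continuity, from `X`). -/
def resExt (A : X →ₗ.[ℂ] X) (s : ℂ) : XNeg A →L[ℂ] X :=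
  (res A s).toLinearMap.extendOfNorm (emb A)

theorem resExt_emb {A : X →ₗ.[ℂ] X} {s : ℂ} (hs : s ∈ rho A) (x : X) :
    resExt A s (emb A x) = res A s x := by
  have hα := basePoint_mem ⟨s, hs⟩
  refine LinearMap.extendOfNorm_eq (f := (res A s).toLinearMap) (e := emb A) (denseRange_emb A)
    ⟨‖ContinuousLinearMap.id ℂ X + (basePoint A - s) • res A s‖, fun y => ?_⟩ x
  have h : res A s y =
      (ContinuousLinearMap.id ℂ X + (basePoint A - s) • res A s) (res A (basePoint A) y) := by
    have := res_sub_res hs hα y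
    simp [← this]
  rw [norm_emb]
  calc ‖res A s y‖ = _ := by rw [h]
    _ ≤ _ := ContinuousLinearMap.le_opNorm _ _

/-- `(s I - A)⁻¹ - (β I - A)⁻¹` maps `X₋₁` into `D(A)`. -/
theorem resExt_sub_mem {A : X →ₗ.[ℂ] X} {s β : ℂ} (hs : s ∈ rho A) (hβ : β ∈ rho A)
    (w : XNeg A) : resExt A s w - resExt A β w ∈ A.domain := by
  have h : ∀ w : XNeg A, resExt A s w - resExt A β w = (β - s) • res A s (resExt A β w) := by
    intro w
    refine (denseRange_emb A).induction_on w ?_ fun x => ?_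
    · exact isClosed_eq (by fun_prop) (by fun_prop)
    · rw [resExt_emb hs, resExt_emb hβ, res_sub_res hs hβ]
  rw [h w]
  exact A.domain.smul_mem _ (res_mem hs _)

end Spaces

section Semigroup

variable {X : Type*} [NormedAddCommGroup X] [InnerProductSpace ℂ X]

/-- `T` (restricted to `[0, ∞)`) is a strongly continuous semigroup of operators on `X`. -/
structure IsC0Semigroup (T : ℝ → X →L[ℂ] X) : Prop where
  zero : T 0 = ContinuousLinearMap.id ℂ X
  add : ∀ s t : ℝ, 0 ≤ s → 0 ≤ t → T (s + t) = (T s).comp (T t)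
  tendsto : ∀ x : X, Tendsto (fun t => T t x) (𝓝[>] 0) (𝓝 x)

/-- `A` is the infinitesimal generator of a strongly continuous semigroup on `X`: `x ∈ D(A)` and
`A x = y` if and only if `(T t x - x) / t → y` as `t ↓ 0`. -/
def IsGenerator (A : X →ₗ.[ℂ] X) : Prop :=
  ∃ T : ℝ → X →L[ℂ] X, IsC0Semigroup T ∧
    ∀ x y : X, (x, y) ∈ A.graph ↔ Tendsto (fun t : ℝ => t⁻¹ • (T t x - x)) (𝓝[>] 0) (𝓝 y)

end Semigroup

/-- A system node `(A, B, C, G)` with input space `U`, state space `X`, output space `Y`. -/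
structure SystemNode (U X Y : Type*) [NormedAddCommGroup U] [InnerProductSpace ℂ U]
    [CompleteSpace U] [NormedAddCommGroup X] [InnerProductSpace ℂ X] [CompleteSpace X]
    [NormedAddCommGroup Y] [InnerProductSpace ℂ Y] [CompleteSpace Y] where
  /-- the semigroup generator -/
  A : X →ₗ.[ℂ] X
  isGenerator : IsGenerator A
  /-- the control operator, in `𝓛(U, X₋₁)` -/
  B : U →L[ℂ] XNeg A
  /-- the observation operator, in `𝓛(X₁, Y)` -/
  C : XOne A →L[ℂ] Y
  /-- the transfer function, defined on `ρ(A)` -/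
  G : rho A → U →L[ℂ] Y
  /-- `G(s) - G(β) = C [(s I - A)⁻¹ - (β I - A)⁻¹] B` -/
  G_sub : ∀ (s β : rho A) (v : U), G s v - G β v =
    C (XOne.mk A (resExt A s (B v) - resExt A β (B v)) (resExt_sub_mem s.2 β.2 (B v)))

namespace SystemNode

variable {U X Y : Type*} [NormedAddCommGroup U] [InnerProductSpace ℂ U] [CompleteSpace U]
  [NormedAddCommGroup X] [InnerProductSpace ℂ X] [CompleteSpace X]
  [NormedAddCommGroup Y] [InnerProductSpace ℂ Y] [CompleteSpace Y]

/-- The set `V` of all pairs `(x, v)` with `A x + B v ∈ X`. -/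
def V (S : SystemNode U X Y) : Set (X × U) :=
  {p | ∃ w : X, AExt S.A p.1 + S.B p.2 = emb S.A w}

/-- The set `𝒟₀` of all pairs of an initial state `x` and an input function
`u ∈ C²([0, ∞), U)` with `(x, u 0) ∈ V`. -/
def D0 (S : SystemNode U X Y) : Set (X × (ℝ → U)) :=
  {p | ContDiffOn ℝ 2 p.2 (Ici 0) ∧ (p.1, p.2 0) ∈ S.V}

/-- `y = C&D (x, v)`, where `C&D (x, v) = C [x - (β I - A)⁻¹ B v] + G(β) v` (for all `β ∈ ρ(A)`)
is the combined observation/feedthrough operator. -/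
def IsCD (S : SystemNode U X Y) (x : X) (v : U) (y : Y) : Prop :=
  ∀ β : rho S.A, ∃ h : x - resExt S.A β (S.B v) ∈ S.A.domain,
    y = S.C (XOne.mk S.A (x - resExt S.A β (S.B v)) h) + S.G β v

/-- For a continuous input function `u` on `[0, ∞)`, `z` is the (classical) state trajectory with
initial state `z₀` and `y` is the output function: `z ∈ C¹([0, ∞), X)`, `z 0 = z₀`,
`z' t = A (z t) + B (u t)` and `y t = C&D (z t, u t)` for all `t ≥ 0`. -/
structure IsTrajectory (S : SystemNode U X Y) (z₀ : X) (u : ℝ → U) (z : ℝ → X) (y : ℝ → Y) :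
    Prop where
  input_cont : ContinuousOn u (Ici 0)
  state_C1 : ContDiffOn ℝ 1 z (Ici 0)
  init : z 0 = z₀
  state_eq : ∀ t, 0 ≤ t → emb S.A (derivWithin z (Ici 0) t) = AExt S.A (z t) + S.B (u t)
  output_eq : ∀ t, 0 ≤ t → S.IsCD (z t) (u t) (y t)

/-- Scattering passive system nodes. -/
def ScatteringPassive (S : SystemNode U X Y) : Prop :=
  ∀ (z₀ : X) (u : ℝ → U), (z₀, u) ∈ S.D0 → ∀ (z : ℝ → X) (y : ℝ → Y), S.IsTrajectory z₀ u z y →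
    ∀ τ : ℝ, 0 < τ →
      ‖z τ‖ ^ 2 - ‖z₀‖ ^ 2 ≤ (∫ t in (0 : ℝ)..τ, ‖u t‖ ^ 2) - ∫ t in (0 : ℝ)..τ, ‖y t‖ ^ 2

/-- Impedance passive system nodes (the input and output spaces coincide). -/
def ImpedancePassive (S : SystemNode U X U) : Prop :=
  ∀ (z₀ : X) (u : ℝ → U), (z₀, u) ∈ S.D0 → ∀ (z : ℝ → X) (y : ℝ → U), S.IsTrajectory z₀ u z y →
    ∀ τ : ℝ, 0 < τ →
      ‖z τ‖ ^ 2 - ‖z₀‖ ^ 2 ≤ 2 * ∫ t in (0 : ℝ)..τ, (inner ℂ (u t) (y t)).re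

/-- `Ss` is related to `Sp` by the diagonal transformation with parameter `k`: if `z` and `y` are
the state trajectory and the output function of `Sp` for `(z₀, u) ∈ 𝒟₀`, then for the same initial
state and the input function `√(k/2) (u/k + y)`, the state trajectory of `Ss` is again `z` and its
output function is `√(k/2) (u/k - y)`. -/
def IsDiagonalTransform (k : ℝ) (Sp Ss : SystemNode U X U) : Prop :=
  ∀ (z₀ : X) (u : ℝ → U), (z₀, u) ∈ Sp.D0 → ∀ (z : ℝ → X) (y : ℝ → U),
    Sp.IsTrajectory z₀ u z y →
      Ss.IsTrajectory z₀ (fun t => √(k / 2) • (k⁻¹ • u t + y t)) z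
        (fun t => √(k / 2) • (k⁻¹ • u t - y t))

end SystemNode

/-- `F ∈ H^∞`: `F` is a bounded analytic operator-valued function on the open right half-plane. -/
def IsHInfty {U : Type*} [NormedAddCommGroup U] [InnerProductSpace ℂ U] (F : ℂ → U →L[ℂ] U) :
    Prop :=
  AnalyticOnNhd ℂ F {s : ℂ | 0 < s.re} ∧ ∃ M : ℝ, ∀ s : ℂ, 0 < s.re → ‖F s‖ ≤ M

end SysNode

end

/-! A system node is determined by the graph of its system operator, the quadruples (x, v, w, y)
with Ax + Bv = w and C&D(x, v) = y (`SystemNode.Rel`). For β in the resolvent set, `rel_iff`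
describes this graph by four bounded operators acting on (βx - w, v). Every element of the graph
starts a trajectory with constant input (`Rel.exists_trajectory`). Hence passivity is a pointwise
inequality on the graph (`passive_iff`), and a transformation of trajectories is also a
transformation of graph elements.

The diagonal map (v, y) ↦ (a, b) is a bijection of U × U under which ‖a‖² - ‖b‖² becomes 2 Re⟨v, y⟩.
A node whose graph is the image of the graph of Σ^p is therefore scattering passive at once. The
substance is that the image is the graph of a node at all (`exists_diagonalRel`). At β = 1,
positivity of the transfer function makes I + kG^p(1) coercive, hence invertible, and solving for v
in terms of (x - w, a) gives the four bounded operators of the new node. The candidate for (I -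
A^s)⁻¹ is injective and belongs to a dissipative operator, so A^s is a generator by the
Lumer-Phillips theorem, which is proved below by Yosida approximation.

For uniqueness, any transform contains the graph of the constructed node, and an inclusion of graphs
with a common resolvent point is an equality (`eq_of_rel_imp`). The formula for G^s comes from graph
elements with w = sx, followed through the diagonal map in both directions. -/

noncomputable section

namespace SysNode

/-! ### Strongly continuous semigroups and the resolvents of their generators -/

section Semigroup

variable {X : Type*} [NormedAddCommGroup X] [InnerProductSpace ℂ X]

namespace IsC0Semigroup

variable {T : ℝ → X →L[ℂ] X}

theorem add_apply (hT : IsC0Semigroup T) {s t : ℝ} (hs : 0 ≤ s) (ht : 0 ≤ t) (x : X) :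
    T (s + t) x = T s (T t x) := by
  rw [hT.add s t hs ht]; rfl

theorem comm_apply (hT : IsC0Semigroup T) {s t : ℝ} (hs : 0 ≤ s) (ht : 0 ≤ t) (x : X) :
    T s (T t x) = T t (T s x) := by
  rw [← hT.add_apply hs ht, ← hT.add_apply ht hs, add_comm]

theorem zero_apply (hT : IsC0Semigroup T) (x : X) : T 0 x = x := by
  rw [hT.zero]; rfl

theorem tendsto_nhdsGE (hT : IsC0Semigroup T) (x : X) :
    Tendsto (fun t => T t x) (𝓝[≥] 0) (𝓝 x) := by
  have h : ContinuousWithinAt (fun t => T t x) (Ioi 0) 0 := by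
    simpa [ContinuousWithinAt, hT.zero_apply] using hT.tendsto x
  have := continuousWithinAt_Ioi_iff_Ici.1 h
  simpa [ContinuousWithinAt, hT.zero_apply] using this

theorem tendsto_smul_exp {x y : X} (c : ℝ)
    (h : Tendsto (fun t : ℝ => t⁻¹ • (T t x - x)) (𝓝[>] 0) (𝓝 y)) :
    Tendsto (fun t : ℝ => t⁻¹ • (Real.exp (c * t) • T t x - x)) (𝓝[>] 0) (𝓝 (y + c • x)) := by
  have h1 : Tendsto (fun t => Real.exp (c * t)) (𝓝[>] 0) (𝓝 1) := by
    have : Continuous fun t => Real.exp (c * t) := by fun_prop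
    simpa using (this.tendsto 0).mono_left nhdsWithin_le_nhds
  have h2 : Tendsto (fun t : ℝ => t⁻¹ • (Real.exp (c * t) - 1)) (𝓝[>] 0) (𝓝 c) := by
    have hd : HasDerivAt (fun t => Real.exp (c * t)) c 0 := by
      simpa using ((hasDerivAt_id (0 : ℝ)).const_mul c).exp
    simpa using (hasDerivAt_iff_tendsto_slope_zero.1 hd).mono_left
      (nhdsWithin_mono (0 : ℝ) fun h (hh : h ∈ Ioi 0) => ne_of_gt hh)
  have h3 := (h1.smul h).add (h2.smul_const x)
  rw [one_smul] at h3
  refine h3.congr fun t => ?_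
  module

theorem smul_exp (hT : IsC0Semigroup T) (c : ℝ) :
    IsC0Semigroup fun t => Real.exp (c * t) • T t where
  zero := by simp [hT.zero]
  add s t hs ht := by
    ext x
    simp [hT.add_apply hs ht, mul_add, Real.exp_add, smul_smul, mul_comm]
  tendsto x := by
    have h : Tendsto (fun t => Real.exp (c * t)) (𝓝[>] 0) (𝓝 1) := by
      have : Continuous fun t => Real.exp (c * t) := by fun_prop
      simpa using (this.tendsto 0).mono_left nhdsWithin_le_nhds
    simpa using h.smul (hT.tendsto x)

variable [CompleteSpace X]

/-- Otherwise there are times tₙ ↓ 0 with ‖T(tₙ)‖ > n + 1. Each orbit converges along them, hence is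
bounded, which contradicts the uniform boundedness principle. -/
theorem exists_bound_near_zero (hT : IsC0Semigroup T) :
    ∃ δ > 0, ∃ M ≥ 1, ∀ t, 0 ≤ t → t ≤ δ → ‖T t‖ ≤ M := by
  by_contra! hcon
  choose t ht0 ht1 htn using fun n : ℕ =>
    hcon (1 / ((n : ℝ) + 1)) (by positivity) ((n : ℝ) + 1) (by simp)
  have htend : Tendsto t atTop (𝓝[≥] 0) := by
    refine tendsto_nhdsWithin_iff.2 ⟨?_, Eventually.of_forall ht0⟩
    exact squeeze_zero ht0 ht1 tendsto_one_div_add_atTop_nhds_zero_nat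
  obtain ⟨C, hC⟩ := banach_steinhaus (g := fun n => T (t n)) fun x => by
    obtain ⟨C, hC⟩ := ((hT.tendsto_nhdsGE x).comp htend).norm.bddAbove_range
    exact ⟨C, fun i => hC (mem_range_self i)⟩
  obtain ⟨n, hn⟩ := exists_nat_gt C
  linarith [hC n, htn n]

theorem exists_bound (hT : IsC0Semigroup T) (b : ℝ) :
    ∃ M, 0 ≤ M ∧ ∀ t, 0 ≤ t → t ≤ b → ‖T t‖ ≤ M := by
  obtain ⟨δ, hδ, M, hM, h⟩ := hT.exists_bound_near_zero
  have key : ∀ n : ℕ, ∀ t, 0 ≤ t → t ≤ (n + 1) * δ → ‖T t‖ ≤ M ^ (n + 1) := by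
    intro n
    induction n with
    | zero => intro t h0 h1; simpa using h t h0 (by simpa using h1)
    | succ n ih =>
      intro t h0 h1
      push_cast at h1
      rcases le_total t δ with h2 | h2
      · exact (h t h0 h2).trans (le_self_pow₀ hM (by simp))
      · have h3 : T t = (T δ).comp (T (t - δ)) := by
          rw [← hT.add _ _ hδ.le (by linarith)]; simp
        rw [h3, pow_succ']
        refine (ContinuousLinearMap.opNorm_comp_le _ _).trans ?_
        exact mul_le_mul (h δ hδ.le le_rfl) (ih _ (by linarith) (by linarith)) (norm_nonneg _)
          (by linarith)
  obtain ⟨n, hn⟩ := exists_nat_gt (b / δ)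
  refine ⟨M ^ (n + 1), by positivity, fun t h0 h1 => key n t h0 ?_⟩
  rw [div_lt_iff₀ hδ] at hn
  linarith

/-- The semigroup axioms say nothing about negative times, so orbits are frozen there by `max t 0`;
this makes them continuous on the whole line and integrable on every interval. -/
theorem continuous_orbit (hT : IsC0Semigroup T) (x : X) :
    Continuous fun t => T (max t 0) x := by
  suffices h : ContinuousOn (fun t => T t x) (Ici 0) from
    h.comp_continuous (by fun_prop) fun t => le_max_right t 0
  intro t₀ ht₀
  simp only [mem_Ici] at ht₀
  obtain ⟨M, hM0, hM⟩ := hT.exists_bound (t₀ + 1)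
  have hle : ∀ s t, 0 ≤ s → s ≤ t → t ≤ t₀ + 1 → ‖T t x - T s x‖ ≤ M * ‖T |t - s| x - x‖ := by
    intro s t hs hst ht
    have h1 : T t x - T s x = T s (T (t - s) x - x) := by
      rw [map_sub, ← hT.add_apply hs (by linarith)]; simp
    rw [h1, abs_of_nonneg (by linarith)]
    exact (T s).le_of_opNorm_le (hM s hs (by linarith)) _
  have habs : Tendsto (fun t => |t - t₀|) (𝓝[Ici 0] t₀) (𝓝[≥] 0) := by
    refine tendsto_nhdsWithin_iff.2 ⟨?_, Eventually.of_forall fun t => abs_nonneg (t - t₀)⟩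
    refine Tendsto.mono_left ?_ nhdsWithin_le_nhds
    have : Continuous fun t => |t - t₀| := by fun_prop
    simpa using this.tendsto t₀
  refine tendsto_iff_norm_sub_tendsto_zero.2 ?_
  have hlim : Tendsto (fun t => M * ‖T |t - t₀| x - x‖) (𝓝[Ici 0] t₀) (𝓝 0) := by
    simpa using (((hT.tendsto_nhdsGE x).comp habs).sub_const x).norm.const_mul M
  refine squeeze_zero' (Eventually.of_forall fun _ => norm_nonneg _) ?_ hlim
  have hlt : ∀ᶠ t in 𝓝[Ici 0] t₀, t < t₀ + 1 :=
    nhdsWithin_le_nhds (Iio_mem_nhds (by linarith))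
  filter_upwards [self_mem_nhdsWithin, hlt] with t ht ht'
  rcases le_total t₀ t with h | h
  · exact hle t₀ t ht₀ h ht'.le
  · rw [norm_sub_rev, abs_sub_comm]
    exact hle t t₀ ht h (by linarith)

theorem hasDerivAt_integral (hT : IsC0Semigroup T) (x : X) (t : ℝ) :
    HasDerivAt (fun t => ∫ r in (0 : ℝ)..t, T (max r 0) x) (T (max t 0) x) t :=
  intervalIntegral.integral_hasDerivAt_right ((hT.continuous_orbit x).intervalIntegrable _ _)
    ((hT.continuous_orbit x).stronglyMeasurableAtFilter _ _) (hT.continuous_orbit x).continuousAt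

theorem apply_integral (hT : IsC0Semigroup T) (x : X) {t h : ℝ} (ht : 0 ≤ t) (hh : 0 ≤ h) :
    T h (∫ r in (0 : ℝ)..t, T (max r 0) x) =
      (∫ r in (0 : ℝ)..(t + h), T (max r 0) x) - ∫ r in (0 : ℝ)..h, T (max r 0) x := by
  have hi := fun a b => (hT.continuous_orbit x).intervalIntegrable (μ := volume) a b
  -- By the semigroup law, T(h) shifts the window of integration from [0, t] to [h, t + h].
  rw [← ContinuousLinearMap.intervalIntegral_comp_comm _ (hi _ _),
    intervalIntegral.integral_interval_sub_left (hi _ _) (hi _ _)]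
  have := intervalIntegral.integral_comp_add_right (a := 0) (b := t) (fun r => T (max r 0) x) h
  rw [zero_add] at this
  rw [← this]
  refine intervalIntegral.integral_congr fun r hr => ?_
  rw [uIcc_of_le ht] at hr
  rw [max_eq_left hr.1, max_eq_left (by linarith [hr.1]), ← hT.add_apply hh hr.1, add_comm]

/-- `∫₀ᵗ T r x dr` belongs to the domain of the generator, which maps it to `T t x - x`. -/
theorem tendsto_integral (hT : IsC0Semigroup T) (x : X) {t : ℝ} (ht : 0 ≤ t) :
    Tendsto (fun h : ℝ => h⁻¹ • (T h (∫ r in (0 : ℝ)..t, T (max r 0) x) -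
      ∫ r in (0 : ℝ)..t, T (max r 0) x)) (𝓝[>] 0) (𝓝 (T t x - x)) := by
  have h1 := (hasDerivAt_iff_tendsto_slope_zero.1 (hT.hasDerivAt_integral x t)).mono_left
    (nhdsWithin_mono (0 : ℝ) fun h (hh : h ∈ Ioi 0) => ne_of_gt hh)
  have h0 := (hasDerivAt_iff_tendsto_slope_zero.1 (hT.hasDerivAt_integral x 0)).mono_left
    (nhdsWithin_mono (0 : ℝ) fun h (hh : h ∈ Ioi 0) => ne_of_gt hh)
  rw [max_eq_left ht] at h1
  rw [max_self, hT.zero_apply] at h0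
  refine (h1.sub h0).congr' ?_
  filter_upwards [self_mem_nhdsWithin] with h hh
  rw [hT.apply_integral x ht (le_of_lt hh), ← smul_sub]
  simp only [zero_add, intervalIntegral.integral_same, sub_zero]
  congr 1
  abel

end IsC0Semigroup

theorem isResolvent_iff {A : X →ₗ.[ℂ] X} {s : ℂ} {R : X →L[ℂ] X} :
    IsResolvent A s R ↔ (∀ x, (R x, s • R x - x) ∈ A.graph) ∧
      ∀ x y, (x, y) ∈ A.graph → R (s • x - y) = x := by
  simp only [IsResolvent, LinearPMap.mem_graph_iff]
  constructor
  · rintro ⟨h1, h2⟩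
    refine ⟨fun x => ?_, ?_⟩
    · obtain ⟨h, hx⟩ := h1 x
      exact ⟨⟨R x, h⟩, rfl, (sub_eq_of_eq_add' (sub_eq_iff_eq_add.1 hx)).symm⟩
    · rintro x y ⟨z, rfl, rfl⟩
      exact h2 z
  · rintro ⟨h1, h2⟩
    refine ⟨fun x => ?_, fun x => h2 _ _ ⟨x, rfl, rfl⟩⟩
    obtain ⟨z, hz, hz'⟩ := h1 x
    refine ⟨hz ▸ z.2, ?_⟩
    have : (⟨R x, hz ▸ z.2⟩ : A.domain) = z := Subtype.ext hz.symm
    rw [this, hz']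
    abel

variable [CompleteSpace X]

/-- The resolvent is the Laplace transform of the semigroup, summed over unit intervals: with S(t) =
e^(-rt) T(t) it equals (I - S(1))⁻¹ ∫₀¹ S(t) dt. This needs only ‖S(1)‖ < 1, which holds for large
r, and no improper integral. -/
theorem IsGenerator.eventually_mem_rho {A : X →ₗ.[ℂ] X} (hA : IsGenerator A) :
    ∀ᶠ r : ℝ in atTop, (r : ℂ) ∈ rho A := by
  obtain ⟨T, hT, hG⟩ := hA
  have hev : ∀ᶠ r : ℝ in atTop, Real.exp (-r) * ‖T 1‖ < 1 := by
    have : Tendsto (fun r : ℝ => Real.exp (-r) * ‖T 1‖) atTop (𝓝 0) := by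
      simpa using (Real.tendsto_exp_neg_atTop_nhds_zero).mul_const ‖T 1‖
    exact this.eventually (gt_mem_nhds one_pos)
  filter_upwards [hev] with r hr
  set S : ℝ → X →L[ℂ] X := fun t => Real.exp (-r * t) • T t with hSdef
  have hS : IsC0Semigroup S := hT.smul_exp (-r)
  have hgS : ∀ x y, (x, y) ∈ A.graph →
      Tendsto (fun t : ℝ => t⁻¹ • (S t x - x)) (𝓝[>] 0) (𝓝 (y + (-r) • x)) := fun x y h => by
    simpa [hSdef] using IsC0Semigroup.tendsto_smul_exp (-r) ((hG x y).1 h)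
  have hSg : ∀ x y, Tendsto (fun t : ℝ => t⁻¹ • (S t x - x)) (𝓝[>] 0) (𝓝 y) →
      (x, y + r • x) ∈ A.graph := fun x y h => by
    refine (hG _ _).2 ((IsC0Semigroup.tendsto_smul_exp (T := S) r h).congr fun t => ?_)
    simp [hSdef, smul_smul, ← Real.exp_add]
  obtain ⟨M, -, hM⟩ := hS.exists_bound 1
  have hi := fun x => (hS.continuous_orbit x).intervalIntegrable (μ := volume) 0 1
  let P : X →L[ℂ] X := LinearMap.mkContinuous
    { toFun := fun x => ∫ t in (0 : ℝ)..1, S (max t 0) x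
      map_add' := fun x y => by
        simp only [map_add]; exact intervalIntegral.integral_add (hi x) (hi y)
      map_smul' := fun c x => by simp } M fun x => by
    have := intervalIntegral.norm_integral_le_of_norm_le_const (a := 0) (b := 1)
      (f := fun t => S (max t 0) x) (C := M * ‖x‖) fun t ht => by
        rw [uIoc_of_le zero_le_one] at ht
        rw [max_eq_left ht.1.le]
        exact (S t).le_of_opNorm_le (hM t ht.1.le ht.2) x
    simpa using this
  have hP : ∀ x, P x = ∫ t in (0 : ℝ)..1, S (max t 0) x := fun x => rfl
  have hPS : ∀ h, 0 ≤ h → ∀ x, P (S h x) = S h (P x) := fun h hh x => by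
    rw [hP, hP, ← ContinuousLinearMap.intervalIntegral_comp_comm _ (hi x)]
    exact intervalIntegral.integral_congr fun t _ => hS.comm_apply (le_max_right t 0) hh x
  have hPA : ∀ x, Tendsto (fun t : ℝ => t⁻¹ • (S t (P x) - P x)) (𝓝[>] 0) (𝓝 (S 1 x - x)) :=
    fun x => hS.tendsto_integral x zero_le_one
  have hnorm : ‖S 1‖ < 1 := by
    simpa [hSdef, norm_smul, abs_of_pos (Real.exp_pos _)] using hr
  let N : (X →L[ℂ] X)ˣ := Units.oneSub (S 1) hnorm
  have hN : ∀ x, (N : X →L[ℂ] X) x = x - S 1 x := fun x => rfl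
  have hN1 : ∀ x, (N : X →L[ℂ] X) ((↑N⁻¹ : X →L[ℂ] X) x) = x := fun x => by
    rw [← mul_apply_eq_comp, N.mul_inv]; rfl
  have hN2 : ∀ x, (↑N⁻¹ : X →L[ℂ] X) ((N : X →L[ℂ] X) x) = x := fun x => by
    rw [← mul_apply_eq_comp, N.inv_mul]; rfl
  refine ⟨(↑N⁻¹ : X →L[ℂ] X) * P, isResolvent_iff.2 ⟨fun x => ?_, fun x y hxy => ?_⟩⟩
  · have hcomm : (↑N⁻¹ : X →L[ℂ] X) (P x) = P ((↑N⁻¹ : X →L[ℂ] X) x) := by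
      have h : (N : X →L[ℂ] X) (P ((↑N⁻¹ : X →L[ℂ] X) x)) = P x := by
        rw [hN, ← hPS 1 zero_le_one, ← map_sub, ← hN, hN1]
      rw [← h, hN2]
    rw [mul_apply_eq_comp, hcomm]
    have := hSg _ _ (hPA ((↑N⁻¹ : X →L[ℂ] X) x))
    convert this using 2
    have h2 := hN1 x
    rw [hN] at h2
    nth_rw 2 [← h2]
    rw [Complex.coe_smul]
    abel
  -- P commutes with S(t), so it may be moved inside the difference quotient at x.
  · have h1 : P (y + (-r) • x) = S 1 x - x := by
      have h := (P.continuous.tendsto _).comp (hgS x y hxy)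
      refine tendsto_nhds_unique (h.congr' ?_) (hPA x)
      filter_upwards [self_mem_nhdsWithin] with t ht
      simp only [Function.comp_apply]
      rw [ContinuousLinearMap.map_smul_of_tower, map_sub, hPS t (le_of_lt ht)]
    have h2 : P ((r : ℂ) • x - y) = (N : X →L[ℂ] X) x := by
      rw [hN, ← neg_sub (S 1 x), ← h1, ← map_neg, Complex.coe_smul]
      congr 1
      module
    rw [mul_apply_eq_comp, h2, hN2]

theorem IsGenerator.rho_nonempty {A : X →ₗ.[ℂ] X} (hA : IsGenerator A) : (rho A).Nonempty :=
  hA.eventually_mem_rho.exists.elim fun r hr => ⟨r, hr⟩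

/-- The averages t⁻¹ ∫₀ᵗ T(r)x dr lie in the domain and tend to x. -/
theorem IsGenerator.dense_domain {A : X →ₗ.[ℂ] X} (hA : IsGenerator A) :
    Dense (A.domain : Set X) := by
  obtain ⟨T, hT, hG⟩ := hA
  intro x
  have h0 := (hasDerivAt_iff_tendsto_slope_zero.1 (hT.hasDerivAt_integral x 0)).mono_left
    (nhdsWithin_mono (0 : ℝ) fun h (hh : h ∈ Ioi 0) => ne_of_gt hh)
  rw [max_self, hT.zero_apply] at h0
  refine mem_closure_of_tendsto h0 ?_
  filter_upwards [self_mem_nhdsWithin] with t ht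
  simp only [zero_add, intervalIntegral.integral_same, sub_zero]
  have := LinearPMap.mem_domain_of_mem_graph ((hG _ _).2 (hT.tendsto_integral x (le_of_lt ht)))
  exact (A.domain.restrictScalars ℝ).smul_mem _ this

end Semigroup

/-! ### Exponentials of bounded operators -/

section LumerPhillips

variable {X : Type*} [NormedAddCommGroup X] [InnerProductSpace ℂ X] [CompleteSpace X]

theorem _root_.HasDerivWithinAt.norm_sq_complex {E : Type*} [NormedAddCommGroup E]
    [InnerProductSpace ℂ E] {f : ℝ → E} {f' : E} {s : Set ℝ} {t : ℝ}
    (h : HasDerivWithinAt f f' s t) :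
    HasDerivWithinAt (fun t => ‖f t‖ ^ 2) (2 * (inner ℂ f' (f t)).re) s t := by
  have h1 := Complex.reCLM.hasFDerivAt.comp_hasDerivWithinAt t (h.inner ℂ h)
  have h2 : ∀ t, ‖f t‖ ^ 2 = (inner ℂ (f t) (f t)).re := fun t => by
    rw [← inner_self_eq_norm_sq (𝕜 := ℂ)]; rfl
  simp only [h2]
  refine h1.congr_deriv ?_
  rw [Complex.reCLM_apply, Complex.add_re, ← inner_conj_symm (f t) f', Complex.conj_re]
  ring

open NormedSpace in
theorem hasDerivAt_exp_smul_apply (Y : X →L[ℂ] X) (x : X) (t : ℝ) :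
    HasDerivAt (fun t : ℝ => exp (t • Y) x) (exp (t • Y) (Y x)) t := by
  have h := hasDerivAt_exp_smul_const (𝕂 := ℝ) Y t
  have h2 := ((ContinuousLinearMap.apply ℂ X x).restrictScalars ℝ).hasFDerivAt.comp_hasDerivAt t h
  exact h2

open NormedSpace in
-- The path r ↦ e^(rY) e^((t-r)Z) x joins the two vectors, and by commutativity its derivative is a
-- contraction applied to Yx - Zx.
theorem norm_exp_smul_apply_sub_le {Y Z : X →L[ℂ] X} (hYZ : Commute Y Z)
    (hY : ∀ t : ℝ, 0 ≤ t → ‖exp (t • Y)‖ ≤ 1) (hZ : ∀ t : ℝ, 0 ≤ t → ‖exp (t • Z)‖ ≤ 1)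
    (x : X) {t : ℝ} (ht : 0 ≤ t) :
    ‖exp (t • Y) x - exp (t • Z) x‖ ≤ t * ‖Y x - Z x‖ := by
  have hd : ∀ r : ℝ, HasDerivAt (fun r : ℝ => (exp (r • Y) * exp ((t - r) • Z)) x)
      ((exp (r • Y) * exp ((t - r) • Z)) (Y x - Z x)) r := by
    intro r
    have h1 := hasDerivAt_exp_smul_const (𝕂 := ℝ) Y r
    have h2 := (hasDerivAt_exp_smul_const (𝕂 := ℝ) Z (t - r)).scomp r
      ((hasDerivAt_id r).const_sub t)
    have h3 := ((ContinuousLinearMap.apply ℂ X x).restrictScalars ℝ).hasFDerivAt.comp_hasDerivAt r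
      (h1.mul h2)
    refine h3.congr_deriv ?_
    have hc : Y * exp ((t - r) • Z) = exp ((t - r) • Z) * Y :=
      ((hYZ.smul_right (t - r)).exp_right).eq
    have : exp (r • Y) * Y * exp ((t - r) • Z) +
        exp (r • Y) * ((-1 : ℝ) • (exp ((t - r) • Z) * Z)) =
        exp (r • Y) * exp ((t - r) • Z) * (Y - Z) := by
      rw [mul_assoc, hc, neg_one_smul, mul_sub, mul_neg, ← sub_eq_add_neg]
      simp only [mul_assoc]
    exact congrArg (fun W : X →L[ℂ] X => W x) this
  have hb : ∀ r ∈ Ico 0 t, ‖(exp (r • Y) * exp ((t - r) • Z)) (Y x - Z x)‖ ≤ ‖Y x - Z x‖ := by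
    intro r hr
    have h1 : ‖exp (r • Y) * exp ((t - r) • Z)‖ ≤ 1 := by
      refine (norm_mul_le _ _).trans ?_
      exact mul_le_one₀ (hY r hr.1) (norm_nonneg _) (hZ _ (by linarith [hr.2]))
    simpa using ContinuousLinearMap.le_of_opNorm_le _ h1 (Y x - Z x)
  have := norm_image_sub_le_of_norm_deriv_le_segment' (fun r _ => (hd r).hasDerivWithinAt) hb t
    ⟨ht, le_rfl⟩
  simpa [mul_comm] using this

open NormedSpace in
-- The auxiliary z stands for an approximation of Yx. The bound involves Y only through Yx and Yz,
-- so it survives a limit of operators Yₙ converging merely on a dense domain that contains x and z.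
theorem norm_exp_smul_apply_sub_sub_le {Y : X →L[ℂ] X}
    (hY : ∀ t : ℝ, 0 ≤ t → ‖exp (t • Y)‖ ≤ 1) (x z : X) {t : ℝ} (ht : 0 ≤ t) :
    ‖exp (t • Y) x - x - t • Y x‖ ≤ t * (2 * ‖Y x - z‖ + t * ‖Y z‖) := by
  have hd : ∀ r : ℝ, HasDerivAt (fun r : ℝ => exp (r • Y) x - r • Y x)
      (exp (r • Y) (Y x) - Y x) r := fun r => by
    have h := (hasDerivAt_exp_smul_apply Y x r).sub ((hasDerivAt_id r).smul_const (Y x))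
    rw [one_smul] at h
    exact h
  have hb : ∀ r ∈ Ico 0 t, ‖exp (r • Y) (Y x) - Y x‖ ≤ 2 * ‖Y x - z‖ + t * ‖Y z‖ := by
    intro r hr
    have h1 : ‖exp (r • Y) z - z‖ ≤ r * ‖Y z‖ := by
      simpa using norm_exp_smul_apply_sub_le (Commute.zero_right Y) hY
        (fun _ _ => by rw [smul_zero, exp_zero]; exact ContinuousLinearMap.norm_id_le) z hr.1
    have h2 : ‖exp (r • Y) (Y x - z)‖ ≤ ‖Y x - z‖ := by
      simpa using ContinuousLinearMap.le_of_opNorm_le _ (hY r hr.1) (Y x - z)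
    have h3 : exp (r • Y) (Y x) - Y x =
        exp (r • Y) (Y x - z) - (Y x - z) + (exp (r • Y) z - z) := by
      rw [map_sub]; abel
    rw [h3]
    have h4 : r * ‖Y z‖ ≤ t * ‖Y z‖ := by gcongr; exact hr.2.le
    linarith [norm_add_le (exp (r • Y) (Y x - z) - (Y x - z)) (exp (r • Y) z - z),
      norm_sub_le (exp (r • Y) (Y x - z)) (Y x - z)]
  have := norm_image_sub_le_of_norm_deriv_le_segment' (fun r _ => (hd r).hasDerivWithinAt) hb t
    ⟨ht, le_rfl⟩
  simp only [zero_smul, exp_zero, one_apply_eq_self, sub_zero, sub_right_comm] at this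
  linarith

/-- Along an orbit, ‖·‖² has derivative 2 Re⟨Yx, x⟩ ≤ 0 at the current point x. -/
theorem norm_exp_smul_le_one {Y : X →L[ℂ] X} (hY : ∀ x, (inner ℂ (Y x) x).re ≤ 0) {t : ℝ}
    (ht : 0 ≤ t) : ‖NormedSpace.exp (t • Y)‖ ≤ 1 := by
  refine ContinuousLinearMap.opNorm_le_bound _ zero_le_one fun x => ?_
  have hd := fun r => (hasDerivAt_exp_smul_apply Y x r).hasDerivWithinAt.norm_sq_complex (s := univ)
  have hanti : Antitone fun r : ℝ => ‖NormedSpace.exp (r • Y) x‖ ^ 2 := by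
    refine antitone_of_hasDerivAt_nonpos (fun r => hasDerivWithinAt_univ.1 (hd r)) fun r => ?_
    have hc : NormedSpace.exp (r • Y) (Y x) = Y (NormedSpace.exp (r • Y) x) :=
      congrArg (fun W : X →L[ℂ] X => W x) (((Commute.refl Y).smul_left r).exp_left).eq
    have := hY (NormedSpace.exp (r • Y) x)
    simp only [hc, Pi.zero_apply]
    linarith
  have h := hanti ht
  simp only [zero_smul, NormedSpace.exp_zero, one_apply_eq_self] at h
  rw [one_mul]
  exact le_of_sq_le_sq h (norm_nonneg _)

end LumerPhillips

/-! ### Dissipative operators and their resolvents -/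

section Dissipative

variable {X : Type*} [NormedAddCommGroup X] [InnerProductSpace ℂ X]

/-- Dissipative operators: `Re ⟨A x, x⟩ ≤ 0` for all `x ∈ D(A)`. -/
def Dissipative (A : X →ₗ.[ℂ] X) : Prop :=
  ∀ x y, (x, y) ∈ A.graph → (inner ℂ y x).re ≤ 0

variable {A : X →ₗ.[ℂ] X}

theorem res_mem_graph {s : ℂ} (hs : s ∈ rho A) (x : X) :
    (res A s x, s • res A s x - x) ∈ A.graph :=
  (isResolvent_iff.1 (res_spec hs)).1 x

theorem res_of_mem_graph {s : ℂ} (hs : s ∈ rho A) {x y : X} (h : (x, y) ∈ A.graph) :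
    res A s (s • x - y) = x :=
  (isResolvent_iff.1 (res_spec hs)).2 x y h

theorem mem_graph_iff_res {s : ℂ} (hs : s ∈ rho A) {x y : X} :
    (x, y) ∈ A.graph ↔ res A s (s • x - y) = x := by
  refine ⟨res_of_mem_graph hs, fun h => ?_⟩
  have := res_mem_graph hs (s • x - y)
  rwa [h, sub_sub_cancel] at this

theorem Dissipative.norm_res_apply_le (hA : Dissipative A) {s : ℂ} (hs : s ∈ rho A)
    (hre : 0 < s.re) (x : X) : ‖res A s x‖ ≤ s.re⁻¹ * ‖x‖ := by
  have h := hA _ _ (res_mem_graph hs x)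
  set z := res A s x
  rw [inner_sub_left, inner_smul_left, Complex.sub_re, inner_self_eq_norm_sq_to_K] at h
  have h1 : ((starRingEnd ℂ) s * ((‖z‖ : ℂ)) ^ 2).re = s.re * ‖z‖ ^ 2 := by
    rw [← Complex.ofReal_pow, Complex.re_mul_ofReal, Complex.conj_re]
  have h2 : (inner ℂ x z).re ≤ ‖x‖ * ‖z‖ := re_inner_le_norm (𝕜 := ℂ) x z
  have h3 : s.re * ‖z‖ ^ 2 ≤ ‖x‖ * ‖z‖ := by
    simp only [Complex.coe_algebraMap] at h
    linarith
  rw [inv_mul_eq_div, le_div_iff₀ hre]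
  rcases (norm_nonneg z).eq_or_lt with h0 | h0
  · rw [← h0]; simp
  · have : (‖z‖ * s.re) * ‖z‖ ≤ ‖x‖ * ‖z‖ := by linarith
    exact le_of_mul_le_mul_right this h0

theorem Dissipative.norm_res_le (hA : Dissipative A) {s : ℂ} (hs : s ∈ rho A)
    (hre : 0 < s.re) : ‖res A s‖ ≤ s.re⁻¹ :=
  ContinuousLinearMap.opNorm_le_bound _ (by positivity) (hA.norm_res_apply_le hs hre)

variable [CompleteSpace X]

/-- Neumann series for the factorization sI - A = (I - (s₀ - s)(s₀I - A)⁻¹)(s₀I - A). -/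
theorem mem_rho_of_norm_lt_one {s₀ s : ℂ} (hs₀ : s₀ ∈ rho A) (h : ‖(s₀ - s) • res A s₀‖ < 1) :
    s ∈ rho A := by
  let N : (X →L[ℂ] X)ˣ := Units.oneSub _ h
  have hN : ∀ x, (N : X →L[ℂ] X) x = x - (s₀ - s) • res A s₀ x := fun x => rfl
  have hN1 : ∀ x, (N : X →L[ℂ] X) ((↑N⁻¹ : X →L[ℂ] X) x) = x := fun x => by
    rw [← mul_apply_eq_comp, N.mul_inv]; rfl
  have hN2 : ∀ x, (↑N⁻¹ : X →L[ℂ] X) ((N : X →L[ℂ] X) x) = x := fun x => by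
    rw [← mul_apply_eq_comp, N.inv_mul]; rfl
  refine ⟨res A s₀ * (↑N⁻¹ : X →L[ℂ] X), isResolvent_iff.2 ⟨fun x => ?_, fun x y hxy => ?_⟩⟩
  · rw [mul_apply_eq_comp]
    have h1 := res_mem_graph hs₀ ((↑N⁻¹ : X →L[ℂ] X) x)
    have h2 := hN1 x
    rw [hN] at h2
    convert h1 using 2
    nth_rw 2 [← h2]
    module
  · have h1 := res_of_mem_graph hs₀ hxy
    have hcomm : ∀ z, (↑N⁻¹ : X →L[ℂ] X) (res A s₀ z) = res A s₀ ((↑N⁻¹ : X →L[ℂ] X) z) := by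
      intro z
      have h : (N : X →L[ℂ] X) (res A s₀ ((↑N⁻¹ : X →L[ℂ] X) z)) = res A s₀ z := by
        rw [hN, ← map_smul, ← map_sub, ← hN, hN1]
      rw [← h, hN2]
    have h2 : res A s₀ (s • x - y) = (N : X →L[ℂ] X) x := by
      have h3 : s • x - y = (s₀ • x - y) - (s₀ - s) • x := by module
      rw [h3, map_sub, h1, map_smul, hN]
    rw [mul_apply_eq_comp, ← hcomm, h2, hN2]

/-- The resolvent bound 1/q at a real point q puts the disc of centre q and radius q into the
resolvent set. It contains 3q/2, so centres can be pushed to infinity, and these discs exhaust the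
half-plane. -/
theorem Dissipative.rightHalfPlane_subset_rho (hA : Dissipative A) {r : ℝ} (hr : 0 < r)
    (hrho : (r : ℂ) ∈ rho A) : {s : ℂ | 0 < s.re} ⊆ rho A := by
  have key : ∀ q : ℝ, 0 < q → (q : ℂ) ∈ rho A → ∀ s : ℂ, ‖(q : ℂ) - s‖ < q → s ∈ rho A := by
    intro q hq hmem s hs
    refine mem_rho_of_norm_lt_one hmem ?_
    rw [norm_smul]
    have h := hA.norm_res_le hmem (by simpa using hq)
    rw [Complex.ofReal_re] at h
    calc _ ≤ ‖(q : ℂ) - s‖ * q⁻¹ := by gcongr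
      _ < 1 := by rwa [mul_inv_lt_iff₀ hq, one_mul]
  have hpow : ∀ n : ℕ, (((3 / 2 : ℝ) ^ n * r : ℝ) : ℂ) ∈ rho A := by
    intro n
    induction n with
    | zero => simpa using hrho
    | succ n ih =>
      have hpos : 0 < (3 / 2 : ℝ) ^ n * r := by positivity
      refine key _ hpos ih _ ?_
      rw [← Complex.ofReal_sub, Complex.norm_real, Real.norm_eq_abs, abs_lt, pow_succ]
      constructor <;> nlinarith
  intro s hs
  simp only [mem_ofPred_eq] at hs
  -- The condition |q - s| < q means |s|² < 2q Re s, which fixes how large q has to be.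
  obtain ⟨n, hn⟩ := pow_unbounded_of_one_lt (‖s‖ ^ 2 / (2 * s.re) / r) (by norm_num : (1 : ℝ) < 3 / 2)
  have hq : 0 < (3 / 2 : ℝ) ^ n * r := by positivity
  refine key _ hq (hpow n) s ?_
  rw [div_lt_iff₀ hr, div_lt_iff₀ (by positivity)] at hn
  refine lt_of_pow_lt_pow_left₀ 2 hq.le ?_
  rw [← Complex.normSq_eq_norm_sq, Complex.normSq_apply] at hn ⊢
  simp only [Complex.sub_re, Complex.ofReal_re, Complex.sub_im, Complex.ofReal_im]
  nlinarith

theorem IsGenerator.rightHalfPlane_subset_rho (hA : IsGenerator A) (hdiss : Dissipative A) :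
    {s : ℂ | 0 < s.re} ⊆ rho A := by
  obtain ⟨r, hr, hr0⟩ := (hA.eventually_mem_rho.and (eventually_gt_atTop 0)).exists
  exact hdiss.rightHalfPlane_subset_rho hr0 hr

/-- For z orthogonal to the domain, dissipativity at (sI - A)⁻¹z leaves only Re s ‖(sI - A)⁻¹z‖² ≤
0, so z = 0. -/
theorem Dissipative.dense_domain (hA : Dissipative A) {s : ℂ} (hre : 0 < s.re)
    (hs : s ∈ rho A) : Dense (A.domain : Set X) := by
  rw [Submodule.dense_iff_topologicalClosure_eq_top, Submodule.topologicalClosure_eq_top_iff,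
    Submodule.eq_bot_iff]
  intro z hz
  have h0 : inner ℂ (res A s z) z = 0 := hz _ (res_mem hs z)
  have h := hA _ _ (res_mem_graph hs z)
  rw [inner_sub_left, ← inner_conj_symm z, h0, inner_smul_left, inner_self_eq_norm_sq_to_K] at h
  have h1 : ((starRingEnd ℂ) s * ((‖res A s z‖ : ℂ)) ^ 2).re = s.re * ‖res A s z‖ ^ 2 := by
    rw [← Complex.ofReal_pow, Complex.re_mul_ofReal, Complex.conj_re]
  simp only [Complex.coe_algebraMap, map_zero, sub_zero] at h
  rw [h1] at h
  have h2 : res A s z = 0 := by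
    have : ‖res A s z‖ ^ 2 ≤ 0 := by nlinarith
    simpa using this
  have h3 := res_mem_graph hs z
  rw [h2] at h3
  simpa using A.graph_fst_eq_zero_snd h3 rfl

end Dissipative

/-! ### Yosida approximation and the Lumer-Phillips theorem -/

section Generation

variable {X : Type*} [NormedAddCommGroup X] [InnerProductSpace ℂ X]

theorem res_comm {A : X →ₗ.[ℂ] X} {s β : ℂ} (hs : s ∈ rho A) (hβ : β ∈ rho A) :
    Commute (res A s) (res A β) := by
  rcases eq_or_ne s β with rfl | hne
  · exact Commute.refl _
  · ext x
    have h1 := res_sub_res hs hβ x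
    have h2 := res_sub_res hβ hs x
    rw [← neg_sub, h1, ← neg_smul, neg_sub] at h2
    exact smul_right_injective X (sub_ne_zero.2 hne) h2

theorem Dissipative.re_inner_yosida_nonpos {A : X →ₗ.[ℂ] X} (hA : Dissipative A) {r : ℝ}
    (hr : 0 < r) (h : (r : ℂ) ∈ rho A) (x : X) :
    (inner ℂ ((r ^ 2 • res A r - r • (1 : X →L[ℂ] X)) x) x).re ≤ 0 := by
  have h1 : ‖res A r x‖ ≤ r⁻¹ * ‖x‖ := by
    simpa using hA.norm_res_apply_le h (by simpa using hr) x
  have h2 : (inner ℂ (res A r x) x).re ≤ ‖res A r x‖ * ‖x‖ := re_inner_le_norm (𝕜 := ℂ) _ _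
  have h3 : (inner ℂ x x).re = ‖x‖ ^ 2 := inner_self_eq_norm_sq (𝕜 := ℂ) x
  have h4 : ((r ^ 2 • res A r - r • (1 : X →L[ℂ] X)) x) =
      ((r ^ 2 : ℝ) : ℂ) • res A r x - (r : ℂ) • x := by
    rw [Complex.coe_smul, Complex.coe_smul]; rfl
  rw [h4, inner_sub_left, inner_smul_left, inner_smul_left, Complex.conj_ofReal,
    Complex.conj_ofReal, Complex.sub_re, Complex.re_ofReal_mul, Complex.re_ofReal_mul, h3]
  have h5 : (inner ℂ (res A r x) x).re ≤ r⁻¹ * ‖x‖ * ‖x‖ := h2.trans (by gcongr)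
  have h6 : r ^ 2 * (inner ℂ (res A r x) x).re ≤ r ^ 2 * (r⁻¹ * ‖x‖ * ‖x‖) := by gcongr
  have h7 : r ^ 2 * (r⁻¹ * ‖x‖ * ‖x‖) = r * ‖x‖ ^ 2 := by field_simp
  linarith

variable [CompleteSpace X]

/-- If bounded operators `Y n` commute, generate contraction semigroups and converge pointwise on
the dense domain of `A`, then the generated semigroups converge pointwise. -/
theorem exists_limit_exp {A : X →ₗ.[ℂ] X} (hd : Dense (A.domain : Set X))
    {Y : ℕ → X →L[ℂ] X} (hcomm : ∀ m n, Commute (Y m) (Y n))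
    (hY : ∀ n, ∀ t : ℝ, 0 ≤ t → ‖NormedSpace.exp (t • Y n)‖ ≤ 1)
    (hlim : ∀ x y, (x, y) ∈ A.graph → Tendsto (fun n => Y n x) atTop (𝓝 y)) :
    ∃ T : ℝ → X →L[ℂ] X, ∀ t, 0 ≤ t → ∀ x,
      Tendsto (fun n => NormedSpace.exp (t • Y n) x) atTop (𝓝 (T t x)) := by
  have hcauchy : ∀ t : ℝ, 0 ≤ t → ∀ x, CauchySeq fun n => NormedSpace.exp (t • Y n) x := by
    intro t ht x
    refine Metric.cauchySeq_iff.2 fun ε hε => ?_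
    obtain ⟨z, hz, hxz⟩ := Metric.dense_iff.1 hd x (ε / 4) (by positivity)
    rw [Metric.mem_ball, dist_eq_norm, norm_sub_rev] at hz
    have hYz := (hlim z _ (A.mem_graph ⟨z, hxz⟩)).cauchySeq
    obtain ⟨N, hN⟩ := Metric.cauchySeq_iff.1 hYz (ε / (4 * (t + 1))) (by positivity)
    refine ⟨N, fun m hm n hn => ?_⟩
    have h1 := hN m hm n hn
    rw [dist_eq_norm] at h1 ⊢
    have h2 := norm_exp_smul_apply_sub_le (hcomm m n) (hY m) (hY n) z ht
    have h3 : t * ‖Y m z - Y n z‖ ≤ ε / 4 := by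
      calc t * ‖Y m z - Y n z‖ ≤ (t + 1) * (ε / (4 * (t + 1))) := by gcongr; linarith
        _ = ε / 4 := by field_simp
    -- The exponentials are contractions, so replacing x by the domain element z costs at most ‖x -
    -- z‖ for each of the two.
    have h4 := fun n => ContinuousLinearMap.le_of_opNorm_le _ (hY n t ht) (x - z)
    simp only [map_sub, one_mul] at h4
    have h5 : NormedSpace.exp (t • Y m) x - NormedSpace.exp (t • Y n) x =
      (NormedSpace.exp (t • Y m) x - NormedSpace.exp (t • Y m) z) +
      (NormedSpace.exp (t • Y m) z - NormedSpace.exp (t • Y n) z) -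
      (NormedSpace.exp (t • Y n) x - NormedSpace.exp (t • Y n) z) := by abel
    rw [h5]
    refine (norm_sub_le _ _).trans_lt ?_
    have h6 := norm_add_le (NormedSpace.exp (t • Y m) x - NormedSpace.exp (t • Y m) z)
      (NormedSpace.exp (t • Y m) z - NormedSpace.exp (t • Y n) z)
    linarith [h4 m, h4 n]
  choose f hf using fun (t : ℝ) (x : X) => cauchySeq_tendsto_of_complete (hcauchy (max t 0)
    (le_max_right t 0) x)
  refine ⟨fun t => continuousLinearMapOfTendsto (fun n => NormedSpace.exp (max t 0 • Y n))
    (tendsto_pi_nhds.2 (hf t)), fun t ht x => ?_⟩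
  have := hf t x
  rw [max_eq_left ht] at this
  exact this

/-- The limit semigroup is differentiable on the domain of A, with derivative A, by the second-order
estimate. That its generator is no larger than A uses the resolvent point 1 and contractivity. -/
theorem isGenerator_of_tendsto {A : X →ₗ.[ℂ] X} (hd : Dense (A.domain : Set X))
    (h1 : (1 : ℂ) ∈ rho A)
    {Y : ℕ → X →L[ℂ] X} (hcomm : ∀ m n, Commute (Y m) (Y n))
    (hY : ∀ n, ∀ t : ℝ, 0 ≤ t → ‖NormedSpace.exp (t • Y n)‖ ≤ 1)
    (hlim : ∀ x y, (x, y) ∈ A.graph → Tendsto (fun n => Y n x) atTop (𝓝 y)) :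
    IsGenerator A := by
  obtain ⟨T, hT⟩ := exists_limit_exp hd hcomm hY hlim
  have hnorm : ∀ t, 0 ≤ t → ∀ x, ‖T t x‖ ≤ ‖x‖ := fun t ht x =>
    le_of_tendsto (hT t ht x).norm (Eventually.of_forall fun n => by
      simpa using ContinuousLinearMap.le_of_opNorm_le _ (hY n t ht) x)
  have hsecond : ∀ x y, (x, y) ∈ A.graph → ∀ z w, (z, w) ∈ A.graph → ∀ t, 0 ≤ t →
      ‖T t x - x - t • y‖ ≤ t * (2 * ‖y - z‖ + t * ‖w‖) := by
    intro x y hxy z w hzw t ht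
    have hl := (((hT t ht x).sub_const x).sub ((hlim x y hxy).const_smul t)).norm
    have hr := (((((hlim x y hxy).sub_const z).norm).const_mul 2).add
      ((hlim z w hzw).norm.const_mul t)).const_mul t
    exact le_of_tendsto_of_tendsto' hl hr fun n => norm_exp_smul_apply_sub_sub_le (hY n) x z ht
  have hgen : ∀ x y, (x, y) ∈ A.graph →
      Tendsto (fun t : ℝ => t⁻¹ • (T t x - x)) (𝓝[>] 0) (𝓝 y) := by
    intro x y hxy
    refine Metric.tendsto_nhds.2 fun ε hε => ?_
    -- The vector y = Ax need not lie in the domain; it is replaced by a nearby z that does.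
    obtain ⟨z, hz, hyz⟩ := Metric.dense_iff.1 hd y (ε / 4) (by positivity)
    rw [Metric.mem_ball, dist_eq_norm, norm_sub_rev] at hz
    set w := A ⟨z, hyz⟩
    have hsmall : ∀ᶠ t : ℝ in 𝓝[>] 0, t * ‖w‖ < ε / 2 := by
      have : Continuous fun t : ℝ => t * ‖w‖ := by fun_prop
      exact nhdsWithin_le_nhds ((this.tendsto 0).eventually (gt_mem_nhds (by simpa using hε)))
    filter_upwards [self_mem_nhdsWithin, hsmall] with t ht hts
    have ht : 0 < t := ht
    have h := hsecond x y hxy z w (A.mem_graph ⟨z, hyz⟩) t ht.le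
    rw [dist_eq_norm]
    have h2 : t⁻¹ • (T t x - x) - y = t⁻¹ • (T t x - x - t • y) := by
      rw [smul_sub _ _ (t • y), inv_smul_smul₀ ht.ne']
    rw [h2, norm_smul, norm_inv, Real.norm_of_nonneg ht.le, inv_mul_lt_iff₀ ht]
    refine h.trans_lt ?_
    gcongr
    linarith
  have hzero : ∀ x, T 0 x = x := fun x =>
    tendsto_nhds_unique (hT 0 le_rfl x) (by simp)
  have hcont : ∀ x, Tendsto (fun t => T t x) (𝓝[>] 0) (𝓝 x) := by
    intro x
    refine Metric.tendsto_nhds.2 fun ε hε => ?_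
    obtain ⟨z, hz, hxz⟩ := Metric.dense_iff.1 hd x (ε / 3) (by positivity)
    rw [Metric.mem_ball, dist_eq_norm, norm_sub_rev] at hz
    have hz0 : Tendsto (fun t : ℝ => t • (t⁻¹ • (T t z - z))) (𝓝[>] 0) (𝓝 0) := by
      have := (tendsto_id.mono_left nhdsWithin_le_nhds).smul
        (hgen z _ (A.mem_graph ⟨z, hxz⟩))
      simpa using this
    have hev := hz0.norm.eventually (gt_mem_nhds (show ‖(0 : X)‖ < ε / 3 by rw [norm_zero]; positivity))
    filter_upwards [self_mem_nhdsWithin, hev] with t ht hev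
    have ht : 0 < t := ht
    rw [smul_inv_smul₀ ht.ne'] at hev
    have h1 := hnorm t ht.le (x - z)
    rw [dist_eq_norm]
    have h2 : T t x - x = T t (x - z) + (T t z - z) - (x - z) := by rw [map_sub]; abel
    rw [h2]
    refine (norm_sub_le _ _).trans_lt ?_
    linarith [norm_add_le (T t (x - z)) (T t z - z)]
  refine ⟨T, ⟨?_, ?_, hcont⟩, fun x y => ⟨hgen x y, fun hxy => ?_⟩⟩
  · ext x; exact hzero x
  · intro s t hs ht
    ext x
    refine tendsto_nhds_unique (hT (s + t) (by positivity) x) ?_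
    have hl : Tendsto (fun n => NormedSpace.exp (s • Y n)
        (NormedSpace.exp (t • Y n) x - T t x)) atTop (𝓝 0) := by
      refine squeeze_zero_norm (fun n => ?_)
        (tendsto_iff_norm_sub_tendsto_zero.1 (hT t ht x))
      simpa using ContinuousLinearMap.le_of_opNorm_le _ (hY n s hs)
        (NormedSpace.exp (t • Y n) x - T t x)
    have := hl.add (hT s hs (T t x))
    rw [zero_add] at this
    refine this.congr fun n => ?_
    let +nondep : NormedAlgebra ℚ (X →L[ℂ] X) := .restrictScalars ℚ ℝ (X →L[ℂ] X)
    rw [add_smul, NormedSpace.exp_add_of_commute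
      (((Commute.refl (Y n)).smul_left s).smul_right t), mul_apply_eq_comp, map_sub]
    abel
  -- The generator of T extends A, and x' in D(A) satisfies x' - Ax' = x - y. So x - x' is an
  -- eigenvector of the generator for the eigenvalue 1, or zero; a contraction semigroup admits only
  -- zero.
  · set x' := res A 1 (x - y) with hx'
    have hg := res_mem_graph h1 (x - y)
    rw [← hx', one_smul] at hg
    have hz : Tendsto (fun t : ℝ => t⁻¹ • (T t (x - x') - (x - x'))) (𝓝[>] 0) (𝓝 (x - x')) := by
      have := hxy.sub (hgen _ _ hg)
      rw [show y - (x' - (x - y)) = x - x' by abel] at this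
      refine this.congr fun t => ?_
      rw [map_sub]
      module
    have hz0 : x - x' = 0 := by
      set d := x - x'
      have hlim := (Complex.continuous_re.tendsto _).comp
        (hz.inner (𝕜 := ℂ) (tendsto_const_nhds (x := d)))
      have hle : (inner ℂ d d).re ≤ 0 := by
        refine le_of_tendsto hlim ?_
        filter_upwards [self_mem_nhdsWithin] with t ht
        have ht : 0 < t := ht
        have h1 : (inner ℂ (T t d) d).re ≤ ‖T t d‖ * ‖d‖ := re_inner_le_norm (𝕜 := ℂ) _ _
        have h2 : (inner ℂ d d).re = ‖d‖ ^ 2 := inner_self_eq_norm_sq (𝕜 := ℂ) d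
        have h3 : ‖T t d‖ * ‖d‖ ≤ ‖d‖ * ‖d‖ := by gcongr; exact hnorm t ht.le d
        simp only [Function.comp_apply]
        rw [← Complex.coe_smul, inner_smul_left, Complex.conj_ofReal, Complex.re_ofReal_mul,
          inner_sub_left, Complex.sub_re, h2]
        exact mul_nonpos_of_nonneg_of_nonpos (by positivity) (by nlinarith)
      have h2 : (inner ℂ d d).re = ‖d‖ ^ 2 := inner_self_eq_norm_sq (𝕜 := ℂ) d
      have : ‖d‖ ^ 2 ≤ 0 := by linarith
      simpa using this
    rw [sub_eq_zero] at hz0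
    rw [← hz0] at hg
    simpa using hg

/-- The Lumer-Phillips theorem (in Hilbert spaces). -/
theorem Dissipative.isGenerator {A : X →ₗ.[ℂ] X} (hA : Dissipative A) (h1 : (1 : ℂ) ∈ rho A) :
    IsGenerator A := by
  have hρ := hA.rightHalfPlane_subset_rho one_pos (by simpa using h1)
  have hd := hA.dense_domain (by simp) h1
  have hpos : ∀ n : ℕ, (0 : ℝ) < n + 1 := fun n => by positivity
  have hmem : ∀ n : ℕ, (((n + 1 : ℝ)) : ℂ) ∈ rho A := fun n => hρ (by simpa using hpos n)
  -- The Yosida approximations r²(rI - A)⁻¹ - rI at r = n + 1, the shift keeping r positive. On D(A)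
  -- they equal r(rI - A)⁻¹A, so they converge to A there once r(rI - A)⁻¹ tends strongly to I.
  set Y : ℕ → X →L[ℂ] X := fun n =>
    (n + 1 : ℝ) ^ 2 • res A ((n + 1 : ℝ) : ℂ) - (n + 1 : ℝ) • (1 : X →L[ℂ] X) with hYdef
  have hone : ∀ z : X, Tendsto (fun n : ℕ => (n + 1 : ℝ) • res A ((n + 1 : ℝ) : ℂ) z) atTop
      (𝓝 z) := by
    have hdom : ∀ n : ℕ, ∀ x y, (x, y) ∈ A.graph →
        (n + 1 : ℝ) • res A ((n + 1 : ℝ) : ℂ) x - x = res A ((n + 1 : ℝ) : ℂ) y := by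
      intro n x y hxy
      have := res_of_mem_graph (hmem n) hxy
      rw [map_sub, map_smul, Complex.coe_smul, sub_eq_iff_eq_add] at this
      rw [this]; abel
    have hbd : ∀ n : ℕ, ∀ x, ‖res A ((n + 1 : ℝ) : ℂ) x‖ ≤ (n + 1 : ℝ)⁻¹ * ‖x‖ := fun n x => by
      have := hA.norm_res_apply_le (hmem n) (by simpa using hpos n) x
      rwa [Complex.ofReal_re] at this
    intro z
    refine Metric.tendsto_nhds.2 fun ε hε => ?_
    obtain ⟨x, hx, hzx⟩ := Metric.dense_iff.1 hd z (ε / 3) (by positivity)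
    rw [Metric.mem_ball, dist_eq_norm, norm_sub_rev] at hx
    set y := A ⟨x, hzx⟩
    have hl : Tendsto (fun n : ℕ => (n + 1 : ℝ)⁻¹ * ‖y‖) atTop (𝓝 0) := by
      simpa using (tendsto_one_div_add_atTop_nhds_zero_nat (𝕜 := ℝ)).mul_const ‖y‖
    filter_upwards [hl.eventually (gt_mem_nhds (show (0 : ℝ) < ε / 3 by positivity))] with n hn
    have h1 := hdom n x y (A.mem_graph ⟨x, hzx⟩)
    have h2 := hbd n y
    have h3 := hbd n (z - x)
    have h4 : ‖(n + 1 : ℝ) • res A ((n + 1 : ℝ) : ℂ) (z - x)‖ ≤ ‖z - x‖ := by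
      rw [norm_smul, Real.norm_of_nonneg (hpos n).le]
      calc _ ≤ (n + 1 : ℝ) * ((n + 1 : ℝ)⁻¹ * ‖z - x‖) := by gcongr
        _ = ‖z - x‖ := by field_simp
    rw [dist_eq_norm]
    have h5 : (n + 1 : ℝ) • res A ((n + 1 : ℝ) : ℂ) z - z =
        (n + 1 : ℝ) • res A ((n + 1 : ℝ) : ℂ) (z - x) + res A ((n + 1 : ℝ) : ℂ) y - (z - x) := by
      rw [← h1, map_sub, smul_sub]; abel
    rw [h5]
    refine (norm_sub_le _ _).trans_lt ?_
    linarith [norm_add_le ((n + 1 : ℝ) • res A ((n + 1 : ℝ) : ℂ) (z - x))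
      (res A ((n + 1 : ℝ) : ℂ) y)]
  refine isGenerator_of_tendsto hd h1 (Y := Y) (fun m n => ?_)
    (fun n t ht => norm_exp_smul_le_one (hA.re_inner_yosida_nonpos (hpos n) (hmem n)) ht)
    fun x y hxy => ?_
  · have h := ((res_comm (hmem m) (hmem n)).smul_left ((m + 1 : ℝ) ^ 2)).smul_right
      ((n + 1 : ℝ) ^ 2)
    have h1 := fun (r : ℝ) (V : X →L[ℂ] X) => (Commute.one_left V).smul_left r
    exact (h.sub_left (h1 _ _)).sub_right (h1 _ _).symm
  · refine (hone y).congr fun n => ?_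
    have := res_of_mem_graph (hmem n) hxy
    rw [map_sub, map_smul, Complex.coe_smul, sub_eq_iff_eq_add, ← sub_eq_iff_eq_add'] at this
    rw [← this]
    simp only [hYdef, sub_apply, smul_apply,
      one_apply_eq_self]
    module

end Generation

/-! ### The spaces X₁ and X₋₁ and the extended operators -/

section Extensions

variable {X : Type*} [NormedAddCommGroup X] [InnerProductSpace ℂ X]

/-- The embedding of `X` into `X₋₁` as a bounded operator. -/
def embL (A : X →ₗ.[ℂ] X) : X →L[ℂ] XNeg A :=
  (emb A).mkContinuous ‖res A (basePoint A)‖ fun x => by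
    rw [norm_emb]; exact ContinuousLinearMap.le_opNorm _ _

/-- The linear map `x ↦ (β I - A) x` on `X₁`. -/
def XOne.shiftAt (A : X →ₗ.[ℂ] X) (β : ℂ) : XOne A →ₗ[ℂ] X :=
  (β • A.domain.subtype - A.toFun : A.domain →ₗ[ℂ] X)

theorem XOne.shiftAt_mk {A : X →ₗ.[ℂ] X} (β : ℂ) {x y : X} (h : (x, y) ∈ A.graph) :
    XOne.shiftAt A β (XOne.mk A x (LinearPMap.mem_domain_of_mem_graph h)) = β • x - y := by
  have : A ⟨x, LinearPMap.mem_domain_of_mem_graph h⟩ = y :=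
    A.mem_graph_snd_inj (A.mem_graph _) h rfl
  exact congrArg (fun z => β • x - z) this

/-- The operator `β I - A ∈ 𝓛(X₁, X)`. -/
def XOne.shiftL (A : X →ₗ.[ℂ] X) (hρ : (rho A).Nonempty) (β : ℂ) : XOne A →L[ℂ] X :=
  (XOne.shiftAt A β).mkContinuous
    ‖ContinuousLinearMap.id ℂ X + (β - basePoint A) • res A (basePoint A)‖ fun x => by
    let x' : A.domain := x
    have h1 : res A (basePoint A) (XOne.shift A x) = x' := (res_spec (basePoint_mem hρ)).2 x'
    have h2 : XOne.shift A x = basePoint A • (x' : X) - A x' := rfl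
    have h3 : XOne.shiftAt A β x = β • (x' : X) - A x' := rfl
    have h4 : XOne.shiftAt A β x =
        (ContinuousLinearMap.id ℂ X + (β - basePoint A) • res A (basePoint A)) (XOne.shift A x) := by
      rw [add_apply, smul_apply, h1, h3, ContinuousLinearMap.id_apply, h2]
      module
    rw [h4]
    exact ContinuousLinearMap.le_opNorm _ _

theorem XOne.shiftL_mk {A : X →ₗ.[ℂ] X} (hρ : (rho A).Nonempty) (β : ℂ) {x y : X}
    (h : (x, y) ∈ A.graph) :
    XOne.shiftL A hρ β (XOne.mk A x (LinearPMap.mem_domain_of_mem_graph h)) = β • x - y :=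
  XOne.shiftAt_mk β h

/-- The resolvent as a bounded operator from `X` to `X₁`. -/
def resOne (A : X →ₗ.[ℂ] X) (β : rho A) : X →L[ℂ] XOne A :=
  LinearMap.mkContinuous
    { toFun := fun x => XOne.mk A (res A β x) (res_mem β.2 x)
      map_add' := fun x y => Subtype.ext (map_add (res A β) x y)
      map_smul' := fun c x => Subtype.ext (map_smul (res A β) c x) }
    ‖ContinuousLinearMap.id ℂ X + (basePoint A - β) • res A β‖ fun x => by
    have h : ‖XOne.mk A (res A β x) (res_mem β.2 x)‖ =
        ‖(ContinuousLinearMap.id ℂ X + (basePoint A - (β : ℂ)) • res A β) x‖ := by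
      rw [XOne.norm_mk, add_apply, smul_apply, ContinuousLinearMap.id_apply,
        A.mem_graph_snd_inj (A.mem_graph _) (res_mem_graph β.2 x) rfl]
      congr 1
      module
    exact h.trans_le (ContinuousLinearMap.le_opNorm _ _)

theorem resOne_shiftL {A : X →ₗ.[ℂ] X} (β : rho A) (hρ : (rho A).Nonempty) (x : XOne A) :
    resOne A β (XOne.shiftL A hρ β x) = x :=
  Subtype.ext ((res_spec β.2).2 (x : A.domain))

theorem XOne.mk_sub {A : X →ₗ.[ℂ] X} {x y : X} (hx : x ∈ A.domain) (hy : y ∈ A.domain)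
    (h : x - y ∈ A.domain) : XOne.mk A (x - y) h = XOne.mk A x hx - XOne.mk A y hy := rfl

theorem XOne.mk_congr {A : X →ₗ.[ℂ] X} {x y : X} (hx : x ∈ A.domain) (hy : y ∈ A.domain)
    (h : x = y) : XOne.mk A x hx = XOne.mk A y hy := by subst h; rfl

variable [CompleteSpace X] {A : X →ₗ.[ℂ] X}

theorem resExt_sub_resExt {s β : ℂ} (hs : s ∈ rho A) (hβ : β ∈ rho A) (w : XNeg A) :
    resExt A s w - resExt A β w = (β - s) • res A s (resExt A β w) := by
  refine (denseRange_emb A).induction_on w ?_ fun x => ?_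
  · exact isClosed_eq (by fun_prop) (by fun_prop)
  · rw [resExt_emb hs, resExt_emb hβ, res_sub_res hs hβ]

/-- With `smul_emb_resExt_sub_AExt`, this says that the extensions of βI - A and of its resolvent
are mutually inverse between X and X₋₁; both identities extend by density. -/
theorem resExt_smul_emb_sub_AExt (hA : IsGenerator A) {β : ℂ} (hβ : β ∈ rho A) (x : X) :
    resExt A β (β • emb A x - AExt A x) = x := by
  refine congrFun (Continuous.ext_on hA.dense_domain
    ((resExt A β).comp (β • embL A - AExt A)).continuous continuous_id fun x hx => ?_) x
  change resExt A β (β • emb A x - AExt A x) = x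
  rw [AExt_apply hA.dense_domain ⟨β, hβ⟩ ⟨x, hx⟩, ← map_smul, ← map_sub, resExt_emb hβ]
  exact res_of_mem_graph hβ (A.mem_graph ⟨x, hx⟩)

theorem smul_emb_resExt_sub_AExt (hA : IsGenerator A) {β : ℂ} (hβ : β ∈ rho A) (w : XNeg A) :
    β • emb A (resExt A β w) - AExt A (resExt A β w) = w := by
  refine congrFun ((denseRange_emb A).equalizer
    ((β • embL A - AExt A).comp (resExt A β)).continuous continuous_id (funext fun x => ?_)) w
  change β • emb A (resExt A β (emb A x)) - AExt A (resExt A β (emb A x)) = emb A x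
  have h := AExt_apply hA.dense_domain ⟨β, hβ⟩ ⟨res A β x, res_mem hβ x⟩
  rw [A.mem_graph_snd_inj (A.mem_graph _) (res_mem_graph hβ x) rfl] at h
  rw [resExt_emb hβ, h, ← map_smul, ← map_sub, sub_sub_cancel]

theorem resExt_injective (hA : IsGenerator A) {β : ℂ} (hβ : β ∈ rho A) :
    Function.Injective (resExt A β) :=
  Function.LeftInverse.injective (g := fun x => β • emb A x - AExt A x)
    (smul_emb_resExt_sub_AExt hA hβ)

end Extensions

/-! ### The graph of the system operator -/

namespace SystemNode

variable {U X Y : Type*} [NormedAddCommGroup U] [InnerProductSpace ℂ U] [CompleteSpace U]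
  [NormedAddCommGroup X] [InnerProductSpace ℂ X] [CompleteSpace X]
  [NormedAddCommGroup Y] [InnerProductSpace ℂ Y] [CompleteSpace Y]

/-- The graph of the system operator: `A x + B v = w` and `C&D (x, v) = y`. -/
def Rel (S : SystemNode U X Y) (x : X) (v : U) (w : X) (y : Y) : Prop :=
  AExt S.A x + S.B v = emb S.A w ∧ S.IsCD x v y

/-- The operator `(β I - A)⁻¹ B ∈ 𝓛(U, X)`. -/
def inputMap (S : SystemNode U X Y) (β : ℂ) : U →L[ℂ] X := (resExt S.A β).comp S.B

/-- The operator `C (β I - A)⁻¹ ∈ 𝓛(X, Y)`. -/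
def outputMap (S : SystemNode U X Y) (β : rho S.A) : X →L[ℂ] Y := S.C.comp (resOne S.A β)

/-- The graph of the system operator in terms of the bounded operators `(β I - A)⁻¹`,
`(β I - A)⁻¹ B`, `C (β I - A)⁻¹` and `G(β)`. -/
theorem rel_iff (S : SystemNode U X Y) (β : rho S.A) {x w : X} {v : U} {y : Y} :
    S.Rel x v w y ↔ x = res S.A β ((β : ℂ) • x - w) + S.inputMap β v ∧
      y = S.outputMap β ((β : ℂ) • x - w) + S.G β v := by
  have hinj := resExt_injective S.isGenerator β.2
  have hstate : AExt S.A x + S.B v = emb S.A w ↔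
      x = res S.A β ((β : ℂ) • x - w) + S.inputMap β v := by
    have h1 := resExt_smul_emb_sub_AExt S.isGenerator β.2 x
    rw [map_sub, map_smul, resExt_emb β.2, sub_eq_iff_eq_add'] at h1
    rw [← hinj.eq_iff, map_add, resExt_emb β.2, map_sub, map_smul, h1]
    change _ + S.inputMap β v = _ ↔ _
    constructor
    · intro h
      rw [← h]; abel
    · intro h
      have h2 : S.inputMap β v = x - (x + resExt S.A β (AExt S.A x) - res S.A β w) := by
        nth_rw 1 [h]; abel
      rw [h2]; abel
  refine and_congr_right_iff.2 (fun _ => Iff.rfl) |>.trans ?_ |>.trans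
    (and_congr_left_iff.2 fun _ => hstate)
  refine and_congr_right_iff.2 fun hx => ?_
  replace hx := hstate.1 hx
  have hsub : x - resExt S.A β (S.B v) = res S.A β ((β : ℂ) • x - w) :=
    sub_eq_iff_eq_add.2 hx
  have hmem : x - resExt S.A β (S.B v) ∈ S.A.domain := hsub ▸ res_mem β.2 _
  have hC : S.C (XOne.mk S.A _ hmem) = S.outputMap β ((β : ℂ) • x - w) :=
    congrArg S.C (XOne.mk_congr _ _ hsub)
  constructor
  · intro h
    obtain ⟨h1, h2⟩ := h β
    rw [h2, ← hC]
  -- Changing β alters the C-term and the G-term by opposite amounts, by the defining identity of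
  -- the transfer function.
  · intro h β'
    have h1 := resExt_sub_mem β'.2 β.2 (S.B v)
    have h2 : x - resExt S.A β' (S.B v) = (x - resExt S.A β (S.B v)) -
      (resExt S.A β' (S.B v) - resExt S.A β (S.B v)) := by abel
    have hmem' : x - resExt S.A β' (S.B v) ∈ S.A.domain :=
      h2 ▸ S.A.domain.sub_mem hmem h1
    refine ⟨hmem', ?_⟩
    rw [XOne.mk_congr hmem' (S.A.domain.sub_mem hmem h1) h2, XOne.mk_sub hmem h1, map_sub, hC, h,
      ← S.G_sub]
    abel

theorem rel_zero_iff (S : SystemNode U X Y) (β : rho S.A) {x w : X} {y : Y} :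
    S.Rel x 0 w y ↔ (x, w) ∈ S.A.graph ∧ y = S.outputMap β ((β : ℂ) • x - w) := by
  rw [S.rel_iff β, mem_graph_iff_res β.2, map_zero, map_zero, add_zero, add_zero, eq_comm]

/-- The element of the graph with `β x - w = f`. -/
theorem rel_mk (S : SystemNode U X Y) (β : rho S.A) (f : X) (v : U) :
    S.Rel (res S.A β f + S.inputMap β v) v ((β : ℂ) • (res S.A β f + S.inputMap β v) - f)
      (S.outputMap β f + S.G β v) := by
  rw [S.rel_iff β, sub_sub_cancel]
  exact ⟨rfl, rfl⟩

/-- At v = 0 the inclusion gives A₁ ⊆ A₂, and a common resolvent point forces equality. Graph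
elements with βx - w = 0 then determine B and G, and those with v = 0 determine C. -/
theorem eq_of_rel_imp {S₁ S₂ : SystemNode U X Y} {β : ℂ} (h₁ : β ∈ rho S₁.A) (h₂ : β ∈ rho S₂.A)
    (h : ∀ x v w y, S₁.Rel x v w y → S₂.Rel x v w y) : S₁ = S₂ := by
  have hle : ∀ x w, (x, w) ∈ S₁.A.graph → (x, w) ∈ S₂.A.graph := fun x w hx =>
    ((S₂.rel_zero_iff ⟨β, h₂⟩).1 (h _ _ _ _ ((S₁.rel_zero_iff ⟨β, h₁⟩).2 ⟨hx, rfl⟩))).1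
  have hA : S₁.A = S₂.A := by
    refine LinearPMap.eq_of_eq_graph (le_antisymm (fun p hp => hle _ _ hp) ?_)
    rintro ⟨x, w⟩ hp
    have h3 := hle _ _ (res_mem_graph h₁ (β • x - w))
    have h4 := res_of_mem_graph h₂ h3
    rw [sub_sub_cancel, res_of_mem_graph h₂ hp] at h4
    exact (mem_graph_iff_res h₁).2 h4.symm
  obtain ⟨A₁, hg₁, B₁, C₁, G₁, hG₁⟩ := S₁
  obtain ⟨A₂, hg₂, B₂, C₂, G₂, hG₂⟩ := S₂
  obtain rfl : A₁ = A₂ := hA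
  have hBG : ∀ (γ : rho A₁) (v : U), B₁ v = B₂ v ∧ G₁ γ v = G₂ γ v := by
    intro γ v
    have h3 := (rel_iff _ γ).1 (h _ _ _ _ (rel_mk ⟨A₁, hg₁, B₁, C₁, G₁, hG₁⟩ γ 0 v))
    simp only [map_zero, zero_add, sub_zero, sub_self] at h3
    exact ⟨resExt_injective hg₁ γ.2 h3.1, h3.2⟩
  obtain rfl : B₁ = B₂ := by ext v; exact (hBG ⟨β, h₁⟩ v).1
  obtain rfl : G₁ = G₂ := by ext γ v; exact (hBG γ v).2
  clear hle hBG
  obtain rfl : C₁ = C₂ := by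
    ext x
    have hρ : (rho A₁).Nonempty := ⟨β, h₁⟩
    have h3 := h _ _ _ _
      (rel_mk ⟨A₁, hg₁, B₁, C₁, G₁, hG₁⟩ ⟨β, h₁⟩ (XOne.shiftL A₁ hρ β x) 0)
    have h4 := ((rel_iff _ ⟨β, h₂⟩).1 h3).2
    simp only [map_zero, add_zero, sub_sub_cancel] at h4
    have h5 := resOne_shiftL ⟨β, h₁⟩ hρ x
    exact (congrArg C₁ h5).symm.trans (h4.trans (congrArg C₂ h5))
  rfl

/-- The system node with given operators `(β I - A)⁻¹ B`, `C (β I - A)⁻¹` and `G(β)`. -/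
def ofMaps (A : X →ₗ.[ℂ] X) (hA : IsGenerator A) (β : rho A) (H : U →L[ℂ] X) (K : X →L[ℂ] Y)
    (D : U →L[ℂ] Y) : SystemNode U X Y where
  A := A
  isGenerator := hA
  B := ((β : ℂ) • embL A - AExt A).comp H
  C := K.comp (XOne.shiftL A (nonempty_of_mem β.2) β)
  -- From C[(sI - A)⁻¹ - (βI - A)⁻¹]B = (β - s) K (βI - A)(sI - A)⁻¹ H and (βI - A)(sI - A)⁻¹ = I +
  -- (β - s)(sI - A)⁻¹.
  G s := D + ((β : ℂ) - s) • K.comp ((ContinuousLinearMap.id ℂ X + ((β : ℂ) - s) • res A s).comp H)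
  G_sub s γ v := by
    set w := (((β : ℂ) • embL A - AExt A).comp H) v
    have hβ : resExt A β w = H v := resExt_smul_emb_sub_AExt hA β.2 (H v)
    have key : ∀ s : rho A, resExt A s w = H v + ((β : ℂ) - s) • res A s (H v) := fun s => by
      rw [← hβ, ← resExt_sub_resExt s.2 β.2]; abel
    have hgr : ∀ s : rho A, (((β : ℂ) - s) • res A s (H v),
        ((β : ℂ) - s) • ((s : ℂ) • res A s (H v) - H v)) ∈ A.graph := fun s =>
      A.graph.smul_mem _ (res_mem_graph s.2 (H v))
    have hg := A.graph.sub_mem (hgr s) (hgr γ)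
    have hd : resExt A s w - resExt A γ w =
        ((β : ℂ) - s) • res A s (H v) - ((β : ℂ) - γ) • res A γ (H v) := by
      rw [key, key]; abel
    rw [ContinuousLinearMap.comp_apply, XOne.mk_congr (resExt_sub_mem s.2 γ.2 w)
      (LinearPMap.mem_domain_of_mem_graph hg) hd]
    refine Eq.trans ?_ (congrArg K (XOne.shiftL_mk (nonempty_of_mem β.2) β hg).symm)
    simp only [add_apply, smul_apply, ContinuousLinearMap.comp_apply, ContinuousLinearMap.id_apply,
      map_add, map_sub, map_smul]
    module

theorem ofMaps_rel_iff {A : X →ₗ.[ℂ] X} (hA : IsGenerator A) (β : rho A) (H : U →L[ℂ] X)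
    (K : X →L[ℂ] Y) (D : U →L[ℂ] Y) {x w : X} {v : U} {y : Y} :
    (ofMaps A hA β H K D).Rel x v w y ↔ x = res A β ((β : ℂ) • x - w) + H v ∧
      y = K ((β : ℂ) • x - w) + D v := by
  have h1 : (ofMaps A hA β H K D).inputMap β v = H v :=
    resExt_smul_emb_sub_AExt hA β.2 (H v)
  have h2 : ∀ f, (ofMaps A hA β H K D).outputMap β f = K f := fun f => by
    have := XOne.shiftL_mk (nonempty_of_mem β.2) β (res_mem_graph β.2 f)
    rw [sub_sub_cancel] at this
    exact congrArg K this
  have h3 : (ofMaps A hA β H K D).G β v = D v := by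
    simp [ofMaps]
  rw [(ofMaps A hA β H K D).rel_iff β, h1, h2, h3]
  rfl

end SystemNode

/-! ### Trajectories and infinitesimal passivity -/

namespace SystemNode

variable {U X Y : Type*} [NormedAddCommGroup U] [InnerProductSpace ℂ U] [CompleteSpace U]
  [NormedAddCommGroup X] [InnerProductSpace ℂ X] [CompleteSpace X]
  [NormedAddCommGroup Y] [InnerProductSpace ℂ Y] [CompleteSpace Y]

theorem Rel.mem_V {S : SystemNode U X Y} {x w : X} {v : U} {y : Y} (h : S.Rel x v w y) :
    (x, v) ∈ S.V := ⟨w, h.1⟩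

theorem IsTrajectory.rel {S : SystemNode U X Y} {z₀ : X} {u : ℝ → U} {z : ℝ → X} {y : ℝ → Y}
    (h : S.IsTrajectory z₀ u z y) {t : ℝ} (ht : 0 ≤ t) :
    S.Rel (z t) (u t) (derivWithin z (Ici 0) t) (y t) :=
  ⟨(h.state_eq t ht).symm, h.output_eq t ht⟩

theorem IsTrajectory.continuousOn_derivWithin {S : SystemNode U X Y} {z₀ : X} {u : ℝ → U}
    {z : ℝ → X} {y : ℝ → Y} (h : S.IsTrajectory z₀ u z y) :
    ContinuousOn (derivWithin z (Ici 0)) (Ici 0) :=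
  h.state_C1.continuousOn_derivWithin (uniqueDiffOn_Ici 0) le_rfl

/-- The output is a bounded operator applied to βz - z' plus one applied to u, and all three
functions are continuous. -/
theorem IsTrajectory.continuousOn_output {S : SystemNode U X Y} {z₀ : X} {u : ℝ → U} {z : ℝ → X}
    {y : ℝ → Y} (h : S.IsTrajectory z₀ u z y) : ContinuousOn y (Ici 0) := by
  obtain ⟨β, hβ⟩ := S.isGenerator.rho_nonempty
  have hz := h.state_C1.continuousOn
  have hz' := h.continuousOn_derivWithin
  have hu := h.input_cont
  have : ContinuousOn (fun t => S.outputMap ⟨β, hβ⟩ (β • z t - derivWithin z (Ici 0) t) +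
      S.G ⟨β, hβ⟩ (u t)) (Ici 0) := by fun_prop
  exact this.congr fun t ht => ((S.rel_iff ⟨β, hβ⟩).1 (h.rel ht)).2

/-- Every element of the graph is the initial value of a trajectory with constant input. -/
theorem Rel.exists_trajectory {S : SystemNode U X Y} {x w : X} {v : U} {y : Y}
    (h : S.Rel x v w y) : ∃ (z : ℝ → X) (η : ℝ → Y), S.IsTrajectory x (fun _ => v) z η ∧
      HasDerivAt z w 0 ∧ Continuous η ∧ η 0 = y := by
  obtain ⟨T, hT, hG⟩ := S.isGenerator
  obtain ⟨β, hβ⟩ := S.isGenerator.rho_nonempty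
  let γ : rho S.A := ⟨β, hβ⟩
  obtain ⟨h1, h2⟩ := (S.rel_iff γ).1 h
  -- For constant input the velocity solves the homogeneous equation from w, so z(t) = x + ∫₀ᵗ T(r)w
  -- dr.
  set J : ℝ → X := fun t => ∫ r in (0 : ℝ)..t, T (max r 0) w with hJ
  have hJd : ∀ t, HasDerivAt J (T (max t 0) w) t := hT.hasDerivAt_integral w
  have hJ0 : J 0 = 0 := intervalIntegral.integral_same
  have hzd : ∀ t, HasDerivAt (fun t => x + J t) (T (max t 0) w) t := fun t =>
    (hJd t).const_add x
  have hTc := hT.continuous_orbit w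
  have hJc : Continuous J := continuous_iff_continuousAt.2 fun t => (hJd t).continuousAt
  set η : ℝ → Y := fun t => y + S.outputMap γ (β • J t - (T (max t 0) w - w)) with hη
  have hηc : Continuous η :=
    continuous_const.add ((S.outputMap γ).continuous.comp ((hJc.const_smul β).sub (hTc.sub continuous_const)))
  have hrel : ∀ t, 0 ≤ t → S.Rel (x + J t) v (T t w) (η t) := fun t ht => by
    have hg := res_of_mem_graph hβ ((hG _ _).2 (hT.tendsto_integral w ht))
    have hsplit : β • (x + J t) - T t w = (β • x - w) + (β • J t - (T t w - w)) := by
      rw [smul_add]; abel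
    refine (S.rel_iff γ).2 ⟨?_, ?_⟩
    · change _ = res S.A β (β • (x + J t) - T t w) + _
      rw [hsplit, map_add, hg, add_right_comm]
      exact congrArg (· + J t) h1
    · change _ = S.outputMap γ (β • (x + J t) - T t w) + _
      simp only [hη, max_eq_left ht]
      rw [hsplit, map_add, add_right_comm]
      exact congrArg (· + S.outputMap γ (β • J t - (T t w - w))) h2
  refine ⟨fun t => x + J t, η,
    ⟨continuousOn_const, ?_, by simp [hJ0], fun t ht => ?_, fun t ht => (hrel t ht).2⟩,
    by simpa [hT.zero_apply] using hzd 0, hηc, by simp [hη, hJ0, hT.zero_apply]⟩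
  · refine ContDiff.contDiffOn (contDiff_one_iff_deriv.2 ⟨fun t => (hzd t).differentiableAt, ?_⟩)
    rwa [funext fun t => (hzd t).deriv]
  · rw [((hzd t).hasDerivWithinAt.derivWithin (uniqueDiffOn_Ici 0 t ht)), max_eq_left ht]
    exact (hrel t ht).1.symm

/-- A passivity inequality with the continuous supply rate `σ` holds if and only if it holds
infinitesimally. -/
theorem passive_iff {S : SystemNode U X Y} {σ : U → Y → ℝ}
    (hσ : Continuous fun p : U × Y => σ p.1 p.2) :
    (∀ (z₀ : X) (u : ℝ → U), (z₀, u) ∈ S.D0 → ∀ (z : ℝ → X) (y : ℝ → Y),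
      S.IsTrajectory z₀ u z y → ∀ τ : ℝ, 0 < τ →
        ‖z τ‖ ^ 2 - ‖z₀‖ ^ 2 ≤ ∫ t in (0 : ℝ)..τ, σ (u t) (y t)) ↔
    ∀ x v w y, S.Rel x v w y → 2 * (inner ℂ w x).re ≤ σ v y := by
  constructor
  · intro h x v w y hrel
    obtain ⟨z, η, htraj, hz, hη, rfl⟩ := hrel.exists_trajectory
    -- Dividing the inequality on [0, t] by t and letting t ↓ 0 gives the pointwise one.
    have hle := h x (fun _ => v) ⟨contDiffOn_const, hrel.mem_V⟩ z η htraj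
    have hz0 := htraj.init
    have hc : Continuous fun t => σ v (η t) := hσ.comp (continuous_const.prodMk hη)
    have hI : HasDerivAt (fun τ => ∫ t in (0 : ℝ)..τ, σ v (η t)) (σ v (η 0)) 0 :=
      intervalIntegral.integral_hasDerivAt_right (hc.intervalIntegrable _ _)
        (hc.stronglyMeasurableAtFilter _ _) hc.continuousAt
    have hN := (hz.hasDerivWithinAt (s := univ)).norm_sq_complex.hasDerivAt univ_mem
    have hmono : 𝓝[>] (0 : ℝ) ≤ 𝓝[≠] 0 := nhdsWithin_mono _ fun t (ht : t ∈ Ioi 0) => ne_of_gt ht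
    have h1 := (hasDerivAt_iff_tendsto_slope_zero.1 hN).mono_left hmono
    have h2 := (hasDerivAt_iff_tendsto_slope_zero.1 hI).mono_left hmono
    rw [hz0] at h1
    refine le_of_tendsto_of_tendsto h1 h2 ?_
    filter_upwards [self_mem_nhdsWithin] with t ht
    have ht : 0 < t := ht
    simp only [zero_add, intervalIntegral.integral_same, sub_zero, smul_eq_mul]
    have := hle t ht
    gcongr
  · intro h z₀ u _ z y htraj τ hτ
    have hy := htraj.continuousOn_output
    have hu := htraj.input_cont
    have hz := htraj.state_C1.continuousOn
    have hc : ContinuousOn (fun t => σ (u t) (y t)) (Ici 0) :=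
      hσ.comp_continuousOn (hu.prodMk hy)
    have hsub : Icc 0 τ ⊆ Ici 0 := Icc_subset_Ici_self
    have hd : ∀ t ∈ Ioo 0 τ, HasDerivWithinAt (fun t => ‖z t‖ ^ 2)
        (2 * (inner ℂ (derivWithin z (Ici 0) t) (z t)).re) (Ioi t) t := fun t ht => by
      have := (htraj.state_C1.differentiableOn one_ne_zero t ht.1.le).hasDerivWithinAt
      exact (this.mono fun r (hr : t < r) => (ht.1.trans hr).le).norm_sq_complex
    have := intervalIntegral.sub_le_integral_of_hasDeriv_right_of_le hτ.le
      ((hz.mono hsub).norm.pow 2) hd ((hc.mono hsub).integrableOn_compact isCompact_Icc)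
      fun t ht => h _ _ _ _ (htraj.rel ht.1.le)
    rw [← htraj.init]
    exact this

theorem impedancePassive_iff {S : SystemNode U X U} : S.ImpedancePassive ↔
    ∀ x v w y, S.Rel x v w y → (inner ℂ w x).re ≤ (inner ℂ v y).re := by
  have h := passive_iff (S := S) (σ := fun v y => 2 * (inner ℂ v y).re) (by fun_prop)
  simp only [intervalIntegral.integral_const_mul] at h
  refine h.trans ?_
  simp

theorem scatteringPassive_iff {S : SystemNode U X Y} : S.ScatteringPassive ↔
    ∀ x v w y, S.Rel x v w y → 2 * (inner ℂ w x).re ≤ ‖v‖ ^ 2 - ‖y‖ ^ 2 := by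
  rw [← passive_iff (S := S) (σ := fun v y => ‖v‖ ^ 2 - ‖y‖ ^ 2) (by fun_prop)]
  refine forall₄_congr fun z₀ u _ z => forall₄_congr fun y htraj τ hτ => ?_
  have hsub : uIcc 0 τ ⊆ Ici 0 := by rw [uIcc_of_le hτ.le]; exact Icc_subset_Ici_self
  rw [intervalIntegral.integral_sub (f := fun t => ‖u t‖ ^ 2) (g := fun t => ‖y t‖ ^ 2)
    ((htraj.input_cont.mono hsub).norm.pow 2).intervalIntegrable
    ((htraj.continuousOn_output.mono hsub).norm.pow 2).intervalIntegrable]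

theorem dissipative_of_rel {S : SystemNode U X Y}
    (h : ∀ x w y, S.Rel x 0 w y → (inner ℂ w x).re ≤ 0) : Dissipative S.A := by
  obtain ⟨β, hβ⟩ := S.isGenerator.rho_nonempty
  exact fun x w hx => h x w _ ((S.rel_zero_iff ⟨β, hβ⟩).2 ⟨hx, rfl⟩)

theorem ImpedancePassive.dissipative {S : SystemNode U X U} (h : S.ImpedancePassive) :
    Dissipative S.A :=
  dissipative_of_rel fun x w y hr => by simpa using impedancePassive_iff.1 h x 0 w y hr

theorem ScatteringPassive.dissipative {S : SystemNode U X Y} (h : S.ScatteringPassive) :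
    Dissipative S.A :=
  dissipative_of_rel fun x w y hr => by
    have := scatteringPassive_iff.1 h x 0 w y hr
    rw [norm_zero] at this
    nlinarith [sq_nonneg ‖y‖]

end SystemNode

/-! ### Coercive operators -/

section Coercive

variable {U : Type*} [NormedAddCommGroup U] [InnerProductSpace ℂ U]

theorem norm_le_of_norm_sq_le_re_inner {N : U →L[ℂ] U}
    (h : ∀ v, ‖v‖ ^ 2 ≤ (inner ℂ v (N v)).re) (v : U) : ‖v‖ ≤ ‖N v‖ := by
  have h1 : (inner ℂ v (N v)).re ≤ ‖v‖ * ‖N v‖ := re_inner_le_norm (𝕜 := ℂ) _ _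
  rcases (norm_nonneg v).eq_or_lt with h0 | h0
  · rw [← h0]; exact norm_nonneg _
  · exact le_of_mul_le_mul_left (by linarith [h v, sq ‖v‖]) h0

variable [CompleteSpace U]

theorem isUnit_of_norm_sq_le_re_inner {N : U →L[ℂ] U}
    (h : ∀ v, ‖v‖ ^ 2 ≤ (inner ℂ v (N v)).re) : IsUnit N :=
  ContinuousLinearMap.isUnit_of_forall_le_norm_inner_map N one_pos fun v => by
    rw [NNReal.coe_one, mul_one, norm_inner_symm]
    exact (h v).trans (Complex.re_le_norm _)

theorem norm_inverse_le_one {N : U →L[ℂ] U}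
    (h : ∀ v, ‖v‖ ^ 2 ≤ (inner ℂ v (N v)).re) : ‖Ring.inverse N‖ ≤ 1 := by
  refine ContinuousLinearMap.opNorm_le_bound _ zero_le_one fun v => ?_
  have h1 := norm_le_of_norm_sq_le_re_inner h (Ring.inverse N v)
  rw [← mul_apply_eq_comp, Ring.mul_inverse_cancel _ (isUnit_of_norm_sq_le_re_inner h)] at h1
  simpa using h1

end Coercive

/-! ### The diagonal transformation of U × U -/

section Diagonal

variable {U : Type*} [NormedAddCommGroup U] [InnerProductSpace ℂ U]

theorem exists_eq_diagonal {k : ℝ} (hk : 0 < k) (a b : U) :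
    ∃ v y : U, a = √(k / 2) • (k⁻¹ • v + y) ∧ b = √(k / 2) • (k⁻¹ • v - y) := by
  have hc : √(k / 2) ≠ 0 := (Real.sqrt_pos.2 (by positivity)).ne'
  refine ⟨(k * (2 * √(k / 2))⁻¹) • (a + b), (2 * √(k / 2))⁻¹ • (a - b), ?_, ?_⟩
  all_goals
    rw [smul_smul, ← mul_assoc, inv_mul_cancel₀ hk.ne', one_mul]
    simp only [← smul_add, ← smul_sub, smul_smul]
    rw [mul_inv, mul_left_comm, mul_inv_cancel₀ hc, mul_one]
    module

/-- Polarization; the factor √(k/2) normalizes the cross term 4k⁻¹ Re⟨v, y⟩ to the impedance supply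
rate. -/
theorem norm_sq_sub_norm_sq_diagonal {k : ℝ} (hk : 0 < k) (v y : U) :
    ‖√(k / 2) • (k⁻¹ • v + y)‖ ^ 2 - ‖√(k / 2) • (k⁻¹ • v - y)‖ ^ 2 = 2 * (inner ℂ v y).re := by
  have h1 := norm_add_sq (𝕜 := ℂ) (k⁻¹ • v) y
  have h2 := norm_sub_sq (𝕜 := ℂ) (k⁻¹ • v) y
  have h3 : (inner ℂ (k⁻¹ • v) y).re = k⁻¹ * (inner ℂ v y).re := by
    rw [← Complex.coe_smul, inner_smul_left, Complex.conj_ofReal, Complex.re_ofReal_mul]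
  simp only [RCLike.re_to_complex, h3] at h1 h2
  rw [norm_smul, norm_smul, mul_pow, mul_pow, h1, h2, Real.norm_eq_abs, sq_abs,
    Real.sq_sqrt (by positivity)]
  field_simp
  ring

end Diagonal

/-- An injective bounded operator is the resolvent `(I - A)⁻¹` of some operator `A`. -/
theorem exists_isResolvent_one {X : Type*} [NormedAddCommGroup X] [InnerProductSpace ℂ X]
    (R : X →L[ℂ] X) (hR : Function.Injective R) : ∃ A : X →ₗ.[ℂ] X, IsResolvent A 1 R := by
  let g : Submodule ℂ (X × X) :=
    LinearMap.range ((R : X →ₗ[ℂ] X).prod ((R : X →ₗ[ℂ] X) - LinearMap.id))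
  have hmem : ∀ {x y}, (x, y) ∈ g ↔ ∃ f, R f = x ∧ R f - f = y := fun {x y} => by
    simp [g, LinearMap.mem_range, Prod.ext_iff]
  have hg : ∀ p ∈ g, p.1 = 0 → p.2 = 0 := by
    rintro ⟨x, y⟩ hp (rfl : x = 0)
    obtain ⟨f, hf, rfl⟩ := hmem.1 hp
    have : f = 0 := hR (by rw [hf, map_zero])
    simp [this]
  refine ⟨g.toLinearPMap, isResolvent_iff.2 ?_⟩
  rw [g.toLinearPMap_graph_eq hg]
  refine ⟨fun x => hmem.2 ⟨x, rfl, by simp⟩, fun x y hxy => ?_⟩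
  obtain ⟨f, rfl, rfl⟩ := hmem.1 hxy
  simp

theorem IsResolvent.res_eq {X : Type*} [NormedAddCommGroup X] [InnerProductSpace ℂ X]
    {A : X →ₗ.[ℂ] X} {s : ℂ} {R : X →L[ℂ] X} (h : IsResolvent A s R) : res A s = R := by
  ext x
  have := res_of_mem_graph ⟨R, h⟩ ((isResolvent_iff.1 h).1 x)
  rwa [sub_sub_cancel] at this

/-- The operator is (sI - A)(βI - A)⁻¹, and its inverse is (βI - A)(sI - A)⁻¹. -/
theorem isUnit_one_add_smul_res {X : Type*} [NormedAddCommGroup X] [InnerProductSpace ℂ X]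
    {A : X →ₗ.[ℂ] X} {s β : ℂ} (hs : s ∈ rho A) (hβ : β ∈ rho A) :
    IsUnit (1 + (s - β) • res A β) := by
  refine ⟨⟨_, 1 - (s - β) • res A s, ?_, ?_⟩, rfl⟩
  all_goals
    ext x
    have h1 := res_sub_res hs hβ x
    have h2 := res_sub_res hβ hs x
    simp only [mul_apply_eq_comp, add_apply, sub_apply, smul_apply, one_apply_eq_self, map_sub,
      map_add, map_smul]
    rw [sub_eq_iff_eq_add] at h1 h2
    rw [← sub_eq_zero]
  · nth_rw 1 [h2]
    module
  · nth_rw 1 [h1]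
    module

/-! ### Positivity of the transfer function and construction of the scattering node -/

namespace SystemNode

variable {U X : Type*} [NormedAddCommGroup U] [InnerProductSpace ℂ U] [CompleteSpace U]
  [NormedAddCommGroup X] [InnerProductSpace ℂ X] [CompleteSpace X]

theorem ImpedancePassive.rho_subset {S : SystemNode U X U} (h : S.ImpedancePassive) :
    {s : ℂ | 0 < s.re} ⊆ rho S.A :=
  S.isGenerator.rightHalfPlane_subset_rho h.dissipative

theorem ScatteringPassive.rho_subset {S : SystemNode U X U} (h : S.ScatteringPassive) :
    {s : ℂ | 0 < s.re} ⊆ rho S.A :=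
  S.isGenerator.rightHalfPlane_subset_rho h.dissipative

/-- The transfer function of an impedance passive system node is positive. -/
theorem ImpedancePassive.re_inner_G_nonneg {S : SystemNode U X U} (h : S.ImpedancePassive)
    (s : rho S.A) (hs : 0 < (s : ℂ).re) (v : U) : 0 ≤ (inner ℂ v (S.G s v)).re := by
  -- Take x = (sI - A)⁻¹Bv, for which w = sx and y = G(s)v; passivity becomes Re s ‖x‖² ≤ Re⟨v,
  -- G(s)v⟩.
  have h1 := impedancePassive_iff.1 h _ _ _ _ (S.rel_mk s 0 v)
  simp only [map_zero, zero_add, sub_zero] at h1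
  refine le_trans ?_ h1
  have h2 : ∀ r : ℝ, ((starRingEnd ℂ) (s : ℂ) * (r : ℂ) ^ 2).re = (s : ℂ).re * r ^ 2 := fun r => by
    rw [← Complex.ofReal_pow, Complex.re_mul_ofReal, Complex.conj_re]
  rw [inner_smul_left, inner_self_eq_norm_sq_to_K]
  exact (mul_nonneg hs.le (sq_nonneg _)).trans_eq (h2 _).symm

theorem ImpedancePassive.norm_sq_le {S : SystemNode U X U} (h : S.ImpedancePassive)
    {k : ℝ} (hk : 0 < k) (s : rho S.A) (hs : 0 < (s : ℂ).re) (v : U) :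
    ‖v‖ ^ 2 ≤ (inner ℂ v ((1 + (k : ℂ) • S.G s) v)).re := by
  have h1 := h.re_inner_G_nonneg s hs v
  have h2 : (inner ℂ v v).re = ‖v‖ ^ 2 := inner_self_eq_norm_sq (𝕜 := ℂ) v
  rw [add_apply, smul_apply, one_apply_eq_self, inner_add_right, inner_smul_right, Complex.add_re,
    Complex.re_ofReal_mul, h2]
  nlinarith

/-- The graph of `Ss` is the image of the graph of `Sp` under the diagonal transformation. -/
def DiagonalRel (k : ℝ) (Sp Ss : SystemNode U X U) : Prop :=
  ∀ x v w y, Ss.Rel x (√(k / 2) • (k⁻¹ • v + y)) w (√(k / 2) • (k⁻¹ • v - y)) ↔ Sp.Rel x v w y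

theorem DiagonalRel.scatteringPassive {k : ℝ} (hk : 0 < k) {Sp Ss : SystemNode U X U}
    (h : DiagonalRel k Sp Ss) (hSp : Sp.ImpedancePassive) : Ss.ScatteringPassive := by
  refine scatteringPassive_iff.2 fun x a w b hr => ?_
  obtain ⟨v, y, rfl, rfl⟩ := exists_eq_diagonal hk a b
  rw [norm_sq_sub_norm_sq_diagonal hk]
  linarith [impedancePassive_iff.1 hSp _ _ _ _ ((h x v w y).1 hr)]

theorem DiagonalRel.isDiagonalTransform {k : ℝ} {Sp Ss : SystemNode U X U}
    (h : DiagonalRel k Sp Ss) : Sp.IsDiagonalTransform k Ss := by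
  intro z₀ u _ z y ht
  have hr := fun t (h0 : 0 ≤ t) => (h _ _ _ _).2 (ht.rel h0)
  exact ⟨((ht.input_cont.const_smul k⁻¹).add ht.continuousOn_output).const_smul _, ht.state_C1,
    ht.init, fun t h0 => (hr t h0).1.symm, fun t h0 => (hr t h0).2⟩

theorem IsDiagonalTransform.rel {k : ℝ} {Sp Ss : SystemNode U X U}
    (h : Sp.IsDiagonalTransform k Ss) {x w : X} {v y : U} (hr : Sp.Rel x v w y) :
    Ss.Rel x (√(k / 2) • (k⁻¹ • v + y)) w (√(k / 2) • (k⁻¹ • v - y)) := by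
  obtain ⟨z, η, htraj, hz, -, rfl⟩ := hr.exists_trajectory
  have h1 := (h x _ ⟨contDiffOn_const, hr.mem_V⟩ z η htraj).rel le_rfl
  rwa [htraj.init, hz.hasDerivWithinAt.derivWithin (uniqueDiffOn_Ici 0 0 self_mem_Ici)] at h1

/-- Existence of the diagonal transform. -/
theorem ImpedancePassive.exists_diagonalRel {Sp : SystemNode U X U} (hSp : Sp.ImpedancePassive)
    {k : ℝ} (hk : 0 < k) : ∃ Ss : SystemNode U X U, DiagonalRel k Sp Ss := by
  have h1 : (1 : ℂ) ∈ rho Sp.A := hSp.rho_subset (by simp)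
  let β : rho Sp.A := ⟨1, h1⟩
  set R := res Sp.A 1
  set H := Sp.inputMap 1
  set K := Sp.outputMap β
  set D := Sp.G β
  have hrel : ∀ {x v w y}, Sp.Rel x v w y ↔ x = R (x - w) + H v ∧ y = K (x - w) + D v :=
    fun {x v w y} => by
      have := Sp.rel_iff β (x := x) (v := v) (w := w) (y := y)
      simp only [β, one_smul] at this
      exact this
  set N : U →L[ℂ] U := 1 + (k : ℂ) • D with hN
  have hNv : ∀ v, N v = v + k • D v := fun v => by rw [← Complex.coe_smul]; rfl
  have hunit : IsUnit N := isUnit_of_norm_sq_le_re_inner (hSp.norm_sq_le hk β (by simp [β]))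
  set E := Ring.inverse N
  have hNE : ∀ v, N (E v) = v := fun v => by
    rw [← mul_apply_eq_comp, Ring.mul_inverse_cancel _ hunit]; rfl
  have hEN : ∀ v, E (N v) = v := fun v => by
    rw [← mul_apply_eq_comp, Ring.inverse_mul_cancel _ hunit]; rfl
  set c := √(k / 2) with hcdef
  have hc : 0 < c := Real.sqrt_pos.2 (by positivity)
  have hc2 : c * c = k / 2 := Real.mul_self_sqrt (by positivity)
  -- The state x as a function of f = x - w when the scattering input vanishes, that is, under the
  -- feedback v = -ky.
  let Rs : X →L[ℂ] X := R - k • (H.comp (E.comp K))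
  have hRs : ∀ f, ∃ y, Sp.Rel (Rs f) (-(k • y)) (Rs f - f) y := by
    intro f
    set V := E (-(k • K f)) with hV
    have hNV : V + k • D V = -(k • K f) := by rw [← hNv, hNE]
    have hV' : V = -(k • (K f + D V)) := by
      rw [smul_add, neg_add, ← hNV]; abel
    refine ⟨K f + D V, ?_⟩
    rw [← hV', hrel, sub_sub_cancel]
    refine ⟨?_, rfl⟩
    rw [hV, ← smul_neg]
    simp only [Rs, sub_apply, smul_apply, ContinuousLinearMap.comp_apply, map_neg,
      ContinuousLinearMap.map_smul_of_tower]
    module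
  -- Under this feedback Re⟨w, x⟩ ≤ -k‖y‖². If x = 0, then y = 0 and v = 0, so (0, w) is in the
  -- graph of A^p and w = 0.
  have hdissRs : ∀ f, (inner ℂ (Rs f - f) (Rs f)).re ≤ 0 ∧ (Rs f = 0 → f = 0) := by
    intro f
    obtain ⟨y, hy⟩ := hRs f
    have hp := impedancePassive_iff.1 hSp _ _ _ _ hy
    have hy2 : (inner ℂ (-(k • y)) y).re = -(k * ‖y‖ ^ 2) := by
      rw [inner_neg_left, ← Complex.coe_smul, inner_smul_left, Complex.conj_ofReal,
        Complex.neg_re, Complex.re_ofReal_mul]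
      congr 2
      exact inner_self_eq_norm_sq (𝕜 := ℂ) y
    rw [hy2] at hp
    refine ⟨hp.trans (by simp only [neg_nonpos]; positivity), fun h0 => ?_⟩
    rw [h0, inner_zero_right, Complex.zero_re] at hp
    have hy0 : y = 0 := by
      have : ‖y‖ ^ 2 ≤ 0 := by
        by_contra! hpos
        nlinarith
      simpa using this
    rw [hy0, h0, smul_zero, neg_zero] at hy
    simpa using Sp.A.graph_fst_eq_zero_snd ((Sp.rel_zero_iff β).1 hy).1 rfl
  obtain ⟨A, hA⟩ := exists_isResolvent_one Rs
    ((injective_iff_map_eq_zero Rs).2 fun f => (hdissRs f).2)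
  have hA1 : (1 : ℂ) ∈ rho A := ⟨Rs, hA⟩
  have hdiss : Dissipative A := fun x w hx => by
    have h2 := (isResolvent_iff.1 hA).2 x w hx
    have h3 := (hdissRs ((1 : ℂ) • x - w)).1
    rwa [h2, one_smul, sub_sub_cancel] at h3
  -- Since 2c² = k, one has 2ca = v + ky = Nv + kKf, so v = E(2ca - kKf). Substituting this into x =
  -- Rf + Hv and b = (2c/k)v - a yields the three maps.
  refine ⟨ofMaps A (hdiss.isGenerator hA1) ⟨1, hA1⟩ ((2 * c) • H.comp E) (-((2 * c) • E.comp K))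
    ((2 * c / k * (2 * c)) • E - 1), fun x v w y => ?_⟩
  rw [ofMaps_rel_iff, hrel]
  simp only [hA.res_eq, one_smul]
  set f := x - w
  set a := c • (k⁻¹ • v + y) with ha
  set V := E ((2 * c) • a - k • K f) with hV
  have hx : Rs f + ((2 * c) • H.comp E) a = R f + H V := by
    simp only [hV, Rs, sub_apply, smul_apply, ContinuousLinearMap.comp_apply, map_sub,
      ContinuousLinearMap.map_smul_of_tower]
    module
  have hb : (-((2 * c) • E.comp K)) f + ((2 * c / k * (2 * c)) • E - 1) a =
      (2 * c / k) • V - a := by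
    simp only [hV, sub_apply, neg_apply, smul_apply, ContinuousLinearMap.comp_apply, map_sub,
      ContinuousLinearMap.map_smul_of_tower, one_apply_eq_self]
    match_scalars <;> field_simp
  have hca : (2 * c) • a = v + k • y := by
    rw [ha, smul_smul, mul_assoc, hc2, smul_add, smul_smul]
    match_scalars <;> field_simp
  have hVv : (c • (k⁻¹ • v - y) = (2 * c / k) • V - a) ↔ V = v := by
    have h2 : c • (k⁻¹ • v - y) = (2 * c / k) • v - a := by
      rw [ha]; match_scalars <;> ring
    rw [h2, sub_left_inj, (smul_right_injective U (by positivity : 2 * c / k ≠ 0)).eq_iff, eq_comm]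
  have hVN : V = v ↔ y = K f + D v := by
    rw [hV, hca]
    constructor
    · intro h
      have h2 := hNE (v + k • y - k • K f)
      rw [h, hNv] at h2
      have h3 : k • y = k • (K f + D v) := by
        rw [smul_add, add_left_cancel (h2.trans (add_sub_assoc _ _ _))]; abel
      exact smul_right_injective U hk.ne' h3
    · intro h
      calc E (v + k • y - k • K f) = E (N v) := by rw [hNv, h]; congr 1; module
        _ = v := hEN v
  rw [hx, hb, hVv, ← hVN]
  exact ⟨fun h => ⟨h.2 ▸ h.1, h.2⟩, fun h => ⟨h.2.symm ▸ h.1, h.2⟩⟩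

end SystemNode

/-! ### Transfer functions and the H^∞ bound -/

namespace SystemNode

variable {U X Y : Type*} [NormedAddCommGroup U] [InnerProductSpace ℂ U] [CompleteSpace U]
  [NormedAddCommGroup X] [InnerProductSpace ℂ X] [CompleteSpace X]
  [NormedAddCommGroup Y] [InnerProductSpace ℂ Y] [CompleteSpace Y]

/-- Graph elements with w = sx relate input to output by the transfer function. Those of Σ^p give
G^s(I + kG^p) = I - kG^p, those of Σ^s give (I + kG^p)(I + G^s) = 2I. So (I + G^s)/2 is the inverse
at every common resolvent point, without positivity. -/
theorem DiagonalRel.transfer {k : ℝ} (hk : 0 < k) {Sp Ss : SystemNode U X U}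
    (h : DiagonalRel k Sp Ss) {s : ℂ} (hp : s ∈ rho Sp.A) (hs : s ∈ rho Ss.A) :
    IsUnit (1 + (k : ℂ) • Sp.G ⟨s, hp⟩) ∧ Ss.G ⟨s, hs⟩ =
      (1 - (k : ℂ) • Sp.G ⟨s, hp⟩) * Ring.inverse (1 + (k : ℂ) • Sp.G ⟨s, hp⟩) := by
  have hc : √(k / 2) ≠ 0 := (Real.sqrt_pos.2 (by positivity)).ne'
  set N := 1 + (k : ℂ) • Sp.G ⟨s, hp⟩ with hN
  have hNv : ∀ v, N v = v + k • Sp.G ⟨s, hp⟩ v := fun v => by rw [← Complex.coe_smul]; rfl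
  have h1 : Ss.G ⟨s, hs⟩ * N = 1 - (k : ℂ) • Sp.G ⟨s, hp⟩ := by
    ext v
    have hr := Sp.rel_mk ⟨s, hp⟩ 0 v
    have h2 := ((Ss.rel_iff ⟨s, hs⟩).1 ((h _ _ _ _).2 hr)).2
    simp only [map_zero, zero_add, sub_zero, sub_self,
      ContinuousLinearMap.map_smul_of_tower] at h2
    have h3 := smul_right_injective U hc h2
    have h4 := congrArg (k • ·) h3
    rw [← ContinuousLinearMap.map_smul_of_tower, smul_sub, smul_add, smul_inv_smul₀ hk.ne'] at h4
    rw [mul_apply_eq_comp, hNv, ← h4, ← Complex.coe_smul]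
    rfl
  have h2 : N * (1 + Ss.G ⟨s, hs⟩) = (2 : ℂ) • 1 := by
    ext a
    have hr := Ss.rel_mk ⟨s, hs⟩ 0 a
    obtain ⟨v, y, ha, hb⟩ := exists_eq_diagonal hk a (Ss.G ⟨s, hs⟩ a)
    simp only [map_zero, zero_add, sub_zero] at hr
    have hr' := hr
    rw [hb] at hr'
    nth_rw 2 [ha] at hr'
    have h3 := ((Sp.rel_iff ⟨s, hp⟩).1 ((h _ _ _ _).1 hr')).2
    simp only [sub_self, map_zero, zero_add] at h3
    have h4 : (1 + Ss.G ⟨s, hs⟩) a = (2 * √(k / 2) * k⁻¹) • v := by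
      rw [add_apply, one_apply_eq_self, hb]
      nth_rw 1 [ha]
      module
    rw [mul_apply_eq_comp, h4, ContinuousLinearMap.map_smul_of_tower, hNv, ← h3, smul_apply,
      one_apply_eq_self]
    nth_rw 1 [ha]
    rw [show (2 : ℂ) = ((2 : ℝ) : ℂ) by norm_num, Complex.coe_smul]
    match_scalars <;> field_simp
  have h3 : (1 + Ss.G ⟨s, hs⟩) * N = (2 : ℂ) • 1 := by
    rw [add_mul, h1, one_mul, hN]
    module
  have hunit : IsUnit N := by
    refine ⟨⟨N, (2 : ℂ)⁻¹ • (1 + Ss.G ⟨s, hs⟩), ?_, ?_⟩, rfl⟩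
    · rw [mul_smul_comm, h2, inv_smul_smul₀ two_ne_zero]
    · rw [smul_mul_assoc, h3, inv_smul_smul₀ two_ne_zero]
  refine ⟨hunit, ?_⟩
  rw [← h1, mul_assoc, Ring.mul_inverse_cancel _ hunit, mul_one]

/-- The analytic continuation of the transfer function given by its data at `β`. -/
def extG (S : SystemNode U X Y) (β : rho S.A) (s : ℂ) : U →L[ℂ] Y :=
  S.G β + ((β : ℂ) - s) • (S.outputMap β).comp
    ((Ring.inverse (1 + (s - β) • res S.A β)).comp (S.inputMap β))

/-- The resolvent at s is recovered from the one at β through (sI - A)⁻¹B = (I + (s - β)(βI -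
A)⁻¹)⁻¹(βI - A)⁻¹B. Analyticity in s thus reduces to that of inversion in a Banach algebra. -/
theorem extG_eq (S : SystemNode U X Y) (β s : rho S.A) : S.extG β s = S.G s := by
  ext v
  obtain ⟨h1, h2⟩ := (S.rel_iff β).1 (S.rel_mk s 0 v)
  simp only [map_zero, zero_add, sub_zero, ← sub_smul, map_smul] at h1 h2
  have hu := isUnit_one_add_smul_res s.2 β.2
  have h3 : (1 + ((s : ℂ) - β) • res S.A β) (S.inputMap s v) = S.inputMap β v := by
    rw [add_apply, smul_apply, one_apply_eq_self]
    nth_rw 1 [h1]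
    module
  have h4 : Ring.inverse (1 + ((s : ℂ) - β) • res S.A β) (S.inputMap β v) = S.inputMap s v := by
    rw [← h3, ← mul_apply_eq_comp, Ring.inverse_mul_cancel _ hu]; rfl
  rw [h2, extG, add_apply, smul_apply, ContinuousLinearMap.comp_apply,
    ContinuousLinearMap.comp_apply, h4, add_comm]

theorem differentiableAt_extG (S : SystemNode U X Y) (β s : rho S.A) :
    DifferentiableAt ℂ (S.extG β) s := by
  have h1 : DifferentiableAt ℂ (fun z : ℂ => Ring.inverse (1 + (z - β) • res S.A β)) s :=
    DifferentiableAt.comp (𝕜 := ℂ) (s : ℂ) (g := Ring.inverse)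
      (differentiableAt_inverse (isUnit_one_add_smul_res s.2 β.2)) (by fun_prop)
  have h2 : DifferentiableAt ℂ (fun z : ℂ => (S.outputMap β).comp
      ((Ring.inverse (1 + (z - β) • res S.A β)).comp (S.inputMap β))) s :=
    (differentiableAt_const _).clm_comp (h1.clm_comp (differentiableAt_const _))
  exact (differentiableAt_const _).add (((differentiableAt_const _).sub differentiableAt_id).smul h2)

/-- Coercivity of I + kG(s) with constant 1 gives invertibility and the bound 1 on the inverse,
uniformly in the half-plane. -/
theorem ImpedancePassive.isHInfty {S : SystemNode U X U} (h : S.ImpedancePassive) {k : ℝ}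
    (hk : 0 < k) (β : rho S.A) : IsHInfty fun s => Ring.inverse (1 + (k : ℂ) • S.extG β s) := by
  have hco : ∀ s : ℂ, 0 < s.re → ∀ v, ‖v‖ ^ 2 ≤ (inner ℂ v ((1 + (k : ℂ) • S.extG β s) v)).re :=
    fun s hs v => by
      rw [S.extG_eq β ⟨s, h.rho_subset hs⟩]
      exact h.norm_sq_le hk ⟨s, h.rho_subset hs⟩ hs v
  refine ⟨DifferentiableOn.analyticOnNhd (fun s hs => DifferentiableAt.differentiableWithinAt ?_)
    (isOpen_lt continuous_const Complex.continuous_re), 1, fun s hs => norm_inverse_le_one (hco s hs)⟩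
  exact DifferentiableAt.comp (𝕜 := ℂ) s (g := Ring.inverse)
    (differentiableAt_inverse (isUnit_of_norm_sq_le_re_inner (hco s hs)))
    (((S.differentiableAt_extG β ⟨s, h.rho_subset hs⟩).const_smul (k : ℂ)).const_add 1)

end SystemNode

end SysNode

end

/-! ### The proposition -/

theorem mainTheorem3 {U X : Type*}
    [NormedAddCommGroup U] [InnerProductSpace ℂ U] [CompleteSpace U]
    [NormedAddCommGroup X] [InnerProductSpace ℂ X] [CompleteSpace X]
    (Sp : SysNode.SystemNode U X U) (hSp : Sp.ImpedancePassive) (k : ℝ) (hk : 0 < k) :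
    -- existence and uniqueness of the scattering passive system node
    (∃! Ss : SysNode.SystemNode U X U, Ss.ScatteringPassive ∧ Sp.IsDiagonalTransform k Ss) ∧
    -- the operators `I + k G^p(s)` are invertible on the right half-plane, with inverse in `H^∞`
    (∃ F : ℂ → U →L[ℂ] U, SysNode.IsHInfty F ∧
      ∀ s : ℂ, 0 < s.re → ∃ h : s ∈ SysNode.rho Sp.A,
        (1 + (k : ℂ) • Sp.G ⟨s, h⟩) * F s = 1 ∧ F s * (1 + (k : ℂ) • Sp.G ⟨s, h⟩) = 1) ∧
    -- the transfer function of the scattering passive system node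
    ∀ Ss : SysNode.SystemNode U X U, Ss.ScatteringPassive → Sp.IsDiagonalTransform k Ss →
      {s : ℂ | 0 < s.re} ⊆ SysNode.rho Ss.A ∧
      ∀ (s : ℂ) (hp : s ∈ SysNode.rho Sp.A) (hs : s ∈ SysNode.rho Ss.A),
        IsUnit (1 + (k : ℂ) • Sp.G ⟨s, hp⟩) ∧
        Ss.G ⟨s, hs⟩ = (1 - (k : ℂ) • Sp.G ⟨s, hp⟩) * Ring.inverse (1 + (k : ℂ) • Sp.G ⟨s, hp⟩) := by
  have h1p : (1 : ℂ) ∈ SysNode.rho Sp.A := hSp.rho_subset (by simp)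
  obtain ⟨S₀, hS₀⟩ := hSp.exists_diagonalRel hk
  have hpass := hS₀.scatteringPassive hk hSp
  have huniq : ∀ Ss : SysNode.SystemNode U X U, Ss.ScatteringPassive →
      Sp.IsDiagonalTransform k Ss → Ss = S₀ := fun Ss hSs hT => by
    refine (SysNode.SystemNode.eq_of_rel_imp (β := 1) (hpass.rho_subset (by simp))
      (hSs.rho_subset (by simp)) fun x a w b hr => ?_).symm
    -- Every input-output pair of the constructed node comes from one of Σ^p, so its graph lies in
    -- that of any other transform.
    obtain ⟨v, y, rfl, rfl⟩ := SysNode.exists_eq_diagonal hk a b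
    exact hT.rel ((hS₀ x v w y).1 hr)
  refine ⟨⟨S₀, ⟨hpass, hS₀.isDiagonalTransform⟩, fun Ss h => huniq Ss h.1 h.2⟩,
    ⟨_, hSp.isHInfty hk ⟨1, h1p⟩, fun s hs => ⟨hSp.rho_subset hs, ?_⟩⟩, fun Ss hSs hT =>
    ⟨hSs.rho_subset, fun s hp hs => ?_⟩⟩
  · rw [Sp.extG_eq ⟨1, h1p⟩ ⟨s, hSp.rho_subset hs⟩]
    have hu := SysNode.isUnit_of_norm_sq_le_re_inner
      (hSp.norm_sq_le hk ⟨s, hSp.rho_subset hs⟩ hs)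
    exact ⟨Ring.mul_inverse_cancel _ hu, Ring.inverse_mul_cancel _ hu⟩
  · obtain rfl := huniq Ss hSs hT
    exact hS₀.transfer hk hp hs
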